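/- Let $\mathbb G$ be a Carnot group, i.e. a connected, simply connected Lie group whose Lie algebra is stratified, $\mathfrak g=\mathfrak g_1\oplus\dots\oplus\mathfrak g_l$ with $[\mathfrak g_1,\mathfrak g_k]=\mathfrak g_{k+1}$ and $\mathfrak g_{l+1}=\{0\}$, of topological dimension $N=\sum_k\dim\mathfrak g_k$ and homogeneous dimension $Q=\sum_k k\dim\mathfrak g_k$, with its Haar measure $\mathbf g_{\mathbb G}$ and dilations $\delta_\lambda=\exp\circ(\lambda^k\text{ on }\mathfrak g_k)\circ\exp^{-1}$, $\lambda>0$. Let $\|\cdot\|$ be a homogeneous norm on $\mathbb G$, i.e. a continuous function $\mathbb G\to[0,\infty)$ with $\|g\|=0$ iff $g=e$, $\|g^{-1}\|=\|g\|$, $\|\delta_\lambda g\|=\lambda\|g\|$ and $\|gh\|\le\|g\|+\|h\|$, and let $d(g,h)=\|h^{-1}g\|$. Write $\mathcal S^{m}(E)=\lim_{\delta\to0}\inf\{\sum_i\operatorname{diam}(B_i)^m\}$, the infimum being over countable covers of $E$ by closed $d$-balls $B_i$ with $\operatorname{diam} B_i\le\delta$. A homogeneous subgroup is a closed subgroup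 invariant under all $\delta_\lambda$; it is a $(\mathbf d_t,\mathbf d_m)$-subgroup if its Lie algebra has dimension $\mathbf d_t$ and its Hausdorff dimension with respect to $d$ is $\mathbf d_m$. Let $\mathbb M,\mathbb H$ be complementary homogeneous subgroups ($\mathbb G=\mathbb M\cdot\mathbb H$, $\mathbb M\cap\mathbb H=\{e\}$), with projections $\mathbf P_{\mathbb M},\mathbf P_{\mathbb H}$ given by $g=\mathbf P_{\mathbb M}g\cdot\mathbf P_{\mathbb H}g$. The graph of $f:\Omega\to\mathbb H$, $\Omega\subset\mathbb M$ open, is $\{m\cdot f(m): m\in\Omega\}$; $f$ is intrinsic Lipschitz if for some $L>0$ every point $p$ of the graph is the only point of the graph in the cone $p\cdot\{g:\|\mathbf P_{\mathbb M}g\|\le \tfrac1L\|\mathbf P_{\mathbb H}g\|\}$. An intrinsic $(\mathbf d_t,\mathbf d_m)$-Lipschitz graph is the graph of an intrinsic Lipschitz function of this kind for some decomposition $\mathbb G=\mathbb M\cdot\mathbb H$ in which $\mathbb M$ is a $(\mathbf d_t,\mathbf d_m)$-subgroup. An intrinsic $(\mathbf d_t,\mathbf d_m)$-Lipschitz surface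 is a nonempty set $S\subset\mathbb G$ each of whose points has an open neighbourhood $U$ such that $S\cap U=S'\cap U$ for some intrinsic $(\mathbf d_t,\mathbf d_m)$-Lipschitz graph $S'$. For $0<p<\infty$ and a family $\Sigma$ of such sets, $M_p(\Sigma)=\inf_f\int_{\mathbb G}f^p\,d\mathbf g_{\mathbb G}$ (with $\inf\emptyset=\infty$), the infimum being over all Borel functions $f:\mathbb G\to[0,\infty)$ with $\int f\,d\sigma_S\ge1$ for all $S\in\Sigma$, where $\sigma_S(A)=\mathcal S^{\mathbf d_m}(S\cap A)$ for Borel sets $A$. **Theorem.** Let $1\le\mathbf d_t\le N-1$, $1\le\mathbf d_m\le Q-1$ and $0<p<\infty$ with $\mathbf d_m\,p\le Q$. Let $\Sigma$ be a collection of intrinsic $(\mathbf d_t,\mathbf d_m)$-Lipschitz graphs in $\mathbb G$ all of which contain a common point $g_0\in\mathbb G$. Then $M_p(\Sigma)=0$. The same holds if $\Sigma$ is a collection of intrinsic $(\mathbf d_t,\mathbf d_m)$-Lipschitz surfaces all of which contain a common point. -/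

import Mathlib

open MeasureTheory Set Filter Topology
open scoped ENNReal

noncomputable section

set_option linter.unusedSectionVars false

/-- The right-nested commutator `[x₁, [x₂, [… , x_m]…]]` of a word `x₁ x₂ … x_m`. -/
def nestedBracket {L : Type*} [LieRing L] : List L → L
  | [] => 0
  | [x] => x
  | x :: y :: t => ⁅x, nestedBracket (y :: t)⁆

/-- The Baker-Campbell-Hausdorff product `log (exp x exp y)` in Dynkin's form
`∑ₙ (-1)ⁿ⁻¹/n ∑_{rᵢ + sᵢ > 0} [x^{r₁} y^{s₁} ⋯ x^{rₙ} y^{sₙ}] / (∑ᵢ (rᵢ + sᵢ) ∏ᵢ rᵢ! sᵢ!)`,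
where `[ ⋯ ]` is the right-nested commutator of the word.
The sum runs over the words of length `∑ᵢ (rᵢ + sᵢ) ≤ l` (so `n, rᵢ, sᵢ ≤ l`): in a Lie algebra
that is nilpotent of step at most `l`, nested commutators of more than `l` letters vanish. -/
def bch {L : Type*} [LieRing L] [LieAlgebra ℝ L] (l : ℕ) (x y : L) : L :=
  ∑ n ∈ Finset.Icc 1 l,
    ∑ w : Fin n → Fin (l + 1) × Fin (l + 1),
      if (∀ i, 0 < ((w i).1 : ℕ) + ((w i).2 : ℕ)) ∧
          ∑ i, (((w i).1 : ℕ) + ((w i).2 : ℕ)) ≤ l then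
        ((-1 : ℝ) ^ (n - 1) / (n : ℝ) /
          (((∑ i, (((w i).1 : ℕ) + ((w i).2 : ℕ)) : ℕ) : ℝ) *
            ((∏ i, (Nat.factorial (w i).1 * Nat.factorial (w i).2) : ℕ) : ℝ))) •
          nestedBracket (List.flatten (List.ofFn fun i =>
            List.replicate ((w i).1 : ℕ) x ++ List.replicate ((w i).2 : ℕ) y))
      else 0

/-- A Carnot group `G` with stratified Lie algebra `𝔤` (finite dimensional, with its vector space
topology), in exponential coordinates of the first kind.  A connected, simply connected
Lie group whose Lie algebra `𝔤 = 𝔤₁ ⊕ ⋯ ⊕ 𝔤_l`, `[𝔤₁, 𝔤_k] = 𝔤_{k+1}`, `𝔤_{l+1} = 0`, is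
stratified is the same thing as the space `𝔤`, transported along the exponential map, with the
Baker-Campbell-Hausdorff product. -/
structure CarnotGroup (𝔤 G : Type*) [LieRing 𝔤] [LieAlgebra ℝ 𝔤] [TopologicalSpace 𝔤]
    [Group G] [TopologicalSpace G] where
  /-- the step `l` -/
  step : ℕ
  /-- `layer k` is `𝔤_k` for `k ≥ 1`; there is no layer of degree `0` -/
  layer : ℕ → Submodule ℝ 𝔤
  layer_zero : layer 0 = ⊥
  layer_eq_bot : ∀ k, step < k → layer k = ⊥
  isInternal : DirectSum.IsInternal layer
  bracket_layer : ∀ k, 1 ≤ k →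
    Submodule.span ℝ {z : 𝔤 | ∃ x ∈ layer 1, ∃ y ∈ layer k, z = ⁅x, y⁆} = layer (k + 1)
  /-- the exponential map -/
  exp : 𝔤 ≃ₜ G
  exp_mul_exp : ∀ x y : 𝔤, exp x * exp y = exp (bch step x y)

namespace CarnotGroup

section Algebra

variable {𝔤 G : Type*} [LieRing 𝔤] [LieAlgebra ℝ 𝔤] [TopologicalSpace 𝔤]
  [Group G] [TopologicalSpace G] (C : CarnotGroup 𝔤 G)

/-- The topological dimension `N`. -/
def topDim (_C : CarnotGroup 𝔤 G) : ℕ := Module.finrank ℝ 𝔤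

/-- The homogeneous dimension `Q = ∑ₖ k dim 𝔤_k`. -/
def homDim : ℕ := ∑ k ∈ Finset.Icc 1 C.step, k * Module.finrank ℝ (C.layer k)

/-- The projection of `𝔤` onto the layer `𝔤_k` along the other layers. -/
def component (k : ℕ) : 𝔤 →ₗ[ℝ] 𝔤 :=
  (C.layer k).subtype ∘ₗ DirectSum.component ℝ ℕ (fun i => C.layer i) k ∘ₗ
    ((LinearEquiv.ofBijective (DirectSum.coeLinearMap C.layer) C.isInternal).symm :
      𝔤 →ₗ[ℝ] DirectSum ℕ fun i => C.layer i)

/-- The dilation of the Lie algebra: multiplication by `t ^ k` on `𝔤_k`. -/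
def lieDilation (t : ℝ) : 𝔤 →ₗ[ℝ] 𝔤 := ∑ k ∈ Finset.Icc 1 C.step, t ^ k • C.component k

/-- The intrinsic dilation of the group, `exp ∘ δ_t ∘ exp⁻¹`. -/
def dilation (t : ℝ) (g : G) : G := C.exp (C.lieDilation t (C.exp.symm g))

/-- Homogeneous subgroups: closed (that is, Lie) subgroups that are invariant under dilations. -/
structure IsHomogeneousSubgroup (M : Subgroup G) : Prop where
  isClosed : IsClosed (M : Set G)
  dilation_mem : ∀ t : ℝ, 0 < t → ∀ g ∈ M, C.dilation t g ∈ M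

/-- The Lie algebra `{X | exp (t X) ∈ M for all t}` of a subgroup; for a closed subgroup
this set is already a linear subspace, and taking the span changes nothing. -/
def lieAlgebraOf (M : Subgroup G) : Submodule ℝ 𝔤 :=
  Submodule.span ℝ {X : 𝔤 | ∀ t : ℝ, C.exp (t • X) ∈ M}

end Algebra

/-- Homogeneous norms on a Carnot group. -/
structure HomogeneousNorm {𝔤 G : Type*} [LieRing 𝔤] [LieAlgebra ℝ 𝔤] [TopologicalSpace 𝔤]
    [Group G] [TopologicalSpace G] (C : CarnotGroup 𝔤 G) where
  /-- the norm as a function -/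
  nrm : G → ℝ
  continuous_nrm : Continuous nrm
  nonneg : ∀ g, 0 ≤ nrm g
  eq_zero_iff : ∀ g, nrm g = 0 ↔ g = 1
  nrm_inv : ∀ g, nrm g⁻¹ = nrm g
  nrm_dilation : ∀ (t : ℝ) (g : G), 0 < t → nrm (C.dilation t g) = t * nrm g
  nrm_mul_le : ∀ g h, nrm (g * h) ≤ nrm g + nrm h

section Metric

variable {𝔤 G : Type*} [LieRing 𝔤] [LieAlgebra ℝ 𝔤] [FiniteDimensional ℝ 𝔤]
  [TopologicalSpace 𝔤] [IsTopologicalAddGroup 𝔤] [ContinuousSMul ℝ 𝔤] [T2Space 𝔤]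
  [Group G] [TopologicalSpace G] [IsTopologicalGroup G] {C : CarnotGroup 𝔤 G}

theorem lieDilation_zero (C : CarnotGroup 𝔤 G) (x : 𝔤) : C.lieDilation 0 x = 0 := by
  simp only [lieDilation, LinearMap.sum_apply, LinearMap.smul_apply]
  refine Finset.sum_eq_zero fun k hk => ?_
  have : k ≠ 0 := by have := Finset.mem_Icc.1 hk; omega
  simp [this]

theorem lieDilation_one (C : CarnotGroup 𝔤 G) (x : 𝔤) : C.lieDilation 1 x = x := by
  classical
  simp only [lieDilation, LinearMap.sum_apply, one_pow, one_smul]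
  set e := LinearEquiv.ofBijective (DirectSum.coeLinearMap C.layer) C.isInternal
  have h1 : ∀ k, C.component k x = ((e.symm x) k : 𝔤) := fun k => rfl
  have h2 : DirectSum.coeLinearMap C.layer (e.symm x) = x := e.apply_symm_apply x
  rw [DirectSum.coeLinearMap_eq_dfinsuppSum, DFinsupp.sum] at h2
  conv_rhs => rw [← h2]
  simp only [h1]
  refine (Finset.sum_subset ?_ ?_).symm
  · intro k hk
    rw [DFinsupp.mem_support_iff] at hk
    have hne : C.layer k ≠ ⊥ := by
      intro hb
      apply hk
      have := ((e.symm x) k).2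
      exact Subtype.ext ((Submodule.mem_bot ℝ).1 (hb.le this))
    rw [Finset.mem_Icc]
    constructor
    · rcases Nat.eq_zero_or_pos k with h0 | h0
      · exact absurd (h0 ▸ C.layer_zero) hne
      · exact h0
    · by_contra hlt
      exact hne (C.layer_eq_bot k (not_le.1 hlt))
  · intro k _ hk
    rw [DFinsupp.notMem_support_iff] at hk
    simp [hk]

theorem continuous_lieDilation (C : CarnotGroup 𝔤 G) (x : 𝔤) :
    Continuous fun t : ℝ => C.lieDilation t x := by
  simp only [lieDilation, LinearMap.sum_apply, LinearMap.smul_apply]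
  fun_prop

theorem exp_zero (C : CarnotGroup 𝔤 G) (n : HomogeneousNorm C) : C.exp 0 = 1 := by
  set a : ℝ := n.nrm (C.exp 0)
  have h : n.nrm (C.dilation 2 (C.exp 0)) = 2 * n.nrm (C.exp 0) :=
    n.nrm_dilation 2 _ (by norm_num)
  have h' : C.dilation 2 (C.exp 0) = C.exp 0 := by simp [dilation]
  rw [h'] at h
  exact (n.eq_zero_iff _).1 (by linarith)

/-- Points of small homogeneous norm are close to the identity. -/
theorem HomogeneousNorm.exists_lt_mem (n : HomogeneousNorm C) {U : Set G} (hU : U ∈ 𝓝 (1 : G)) :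
    ∃ c : ℝ, 0 < c ∧ ∀ g, n.nrm g < c → g ∈ U := by
  set T := toEuclidean (E := 𝔤)
  have h1 : (fun v => C.exp (T.symm v)) ⁻¹' U ∈ 𝓝 (0 : EuclideanSpace ℝ _) := by
    apply ContinuousAt.preimage_mem_nhds
    · exact (C.exp.continuous.comp T.symm.continuous).continuousAt
    · simpa [C.exp_zero n] using hU
  obtain ⟨ε, hε, hball⟩ := Metric.mem_nhds_iff.1 h1
  set K := Metric.sphere (0 : EuclideanSpace ℝ (Fin (Module.finrank ℝ 𝔤))) (ε / 2)
  have hcont : Continuous fun v => n.nrm (C.exp (T.symm v)) :=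
    n.continuous_nrm.comp (C.exp.continuous.comp T.symm.continuous)
  have hpos : ∀ v ∈ K, 0 < n.nrm (C.exp (T.symm v)) := by
    intro v hv
    refine lt_of_le_of_ne (n.nonneg _) fun h0 => ?_
    have := (n.eq_zero_iff _).1 h0.symm
    rw [← C.exp_zero n] at this
    have hv0 : v = 0 := by simpa using C.exp.injective this
    have hn : ‖v‖ = ε / 2 := by simpa [K] using hv
    rw [hv0, norm_zero] at hn
    linarith
  obtain ⟨c, hc, hcK⟩ : ∃ c : ℝ, 0 < c ∧ ∀ v ∈ K, c ≤ n.nrm (C.exp (T.symm v)) := by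
    rcases K.eq_empty_or_nonempty with he | hne
    · exact ⟨1, one_pos, by simp [he]⟩
    · obtain ⟨v, hv, hmin⟩ := (isCompact_sphere _ _).exists_isMinOn hne hcont.continuousOn
      exact ⟨_, hpos v hv, fun w hw => hmin hw⟩
  refine ⟨c, hc, fun g hg => ?_⟩
  by_contra hgU
  set x := C.exp.symm g
  have hx : ε ≤ ‖T x‖ := by
    by_contra hlt
    have : T x ∈ (fun v => C.exp (T.symm v)) ⁻¹' U := hball (by simpa using hlt)
    exact hgU (by simpa [x] using this)
  have hf : Continuous fun t : ℝ => ‖T (C.lieDilation t x)‖ :=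
    (T.continuous.comp (C.continuous_lieDilation x)).norm
  obtain ⟨t, ht, hteq⟩ := intermediate_value_Icc (zero_le_one' ℝ) hf.continuousOn
    (show ε / 2 ∈ Icc _ _ by
      simp only [C.lieDilation_zero, C.lieDilation_one, map_zero, norm_zero]
      exact ⟨by linarith, by linarith⟩)
  have ht0 : 0 < t := by
    refine lt_of_le_of_ne ht.1 fun h0 => ?_
    subst h0
    simp only [C.lieDilation_zero, map_zero, norm_zero] at hteq
    linarith
  have h2 := hcK (T (C.lieDilation t x)) (by simpa [K] using hteq)
  have h3 : n.nrm (C.dilation t g) = t * n.nrm g := n.nrm_dilation t g ht0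
  have h4 : C.exp (T.symm (T (C.lieDilation t x))) = C.dilation t g := by simp [dilation, x]
  rw [h4, h3] at h2
  nlinarith [n.nonneg g, ht.2]

/-- The distance `d(p, q) = ‖q⁻¹ p‖`, as a metric on `G` that induces the topology of `G`. -/
@[reducible] def HomogeneousNorm.metricSpace (n : HomogeneousNorm C) : MetricSpace G :=
  let m : MetricSpace G :=
    { dist := fun p q => n.nrm (q⁻¹ * p)
      dist_self := fun p => by simp [n.eq_zero_iff]
      dist_comm := fun p q => by rw [← n.nrm_inv]; simp
      dist_triangle := fun p q r => by
        have := n.nrm_mul_le (r⁻¹ * q) (q⁻¹ * p)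
        rw [show r⁻¹ * q * (q⁻¹ * p) = r⁻¹ * p by group] at this
        linarith
      eq_of_dist_eq_zero := fun {p q} h => by
        have := (n.eq_zero_iff _).1 h
        exact (inv_mul_eq_one.1 this).symm }
  m.replaceTopology (by
    refine TopologicalSpace.ext_nhds fun p => ?_
    refine Filter.ext fun U => ?_
    rw [@Metric.mem_nhds_iff G m.toPseudoMetricSpace]
    constructor
    · intro hU
      have h1 : (fun g => p * g) ⁻¹' U ∈ 𝓝 (1 : G) :=
        (continuous_const_mul p).continuousAt.preimage_mem_nhds (by simpa using hU)
      obtain ⟨c, hc, h⟩ := n.exists_lt_mem h1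
      refine ⟨c, hc, fun q hq => ?_⟩
      have := h (p⁻¹ * q) hq
      simpa using this
    · rintro ⟨c, hc, h⟩
      have ho : IsOpen {q : G | n.nrm (p⁻¹ * q) < c} :=
        isOpen_lt (n.continuous_nrm.comp (continuous_const_mul p⁻¹)) continuous_const
      refine Filter.mem_of_superset (ho.mem_nhds ?_) h
      have : n.nrm 1 = 0 := (n.eq_zero_iff 1).2 rfl
      simpa [this] using hc)

/-- The spherical Hausdorff measure `𝒮^d` of the distance of `n`, without normalising constant:
`𝒮^d(E)` is the limit for `δ → 0` of the infimum of `∑ diam(Bᵢ)^d` over the countable covers of `E`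
by closed balls `Bᵢ` of diameter at most `δ`. -/
def HomogeneousNorm.sphericalMeasure [MeasurableSpace G] [BorelSpace G] (n : HomogeneousNorm C)
    (d : ℝ) : Measure G :=
  letI := n.metricSpace
  Measure.mkMetric' fun s : Set G =>
    ⨅ (x : G) (r : ℝ) (_ : s = Metric.closedBall x r), Metric.ediam s ^ d

/-- The metric (that is, Hausdorff) dimension of a set, for the distance of `n`. -/
def HomogeneousNorm.metricDim (n : HomogeneousNorm C) (A : Set G) : ℝ≥0∞ :=
  letI := n.metricSpace
  dimH A

/-- `(d_t, d_m)`-subgroups: homogeneous subgroups of topological dimension `d_t` and metric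
dimension `d_m`. -/
structure HomogeneousNorm.IsDimSubgroup (n : HomogeneousNorm C) (dt dm : ℕ) (M : Subgroup G) :
    Prop where
  isHomogeneous : C.IsHomogeneousSubgroup M
  topDim_eq : Module.finrank ℝ (C.lieAlgebraOf M) = dt
  metricDim_eq : n.metricDim (M : Set G) = dm

/-- The intrinsic cone `C_{M,H}(q, β) = q · {p | ‖P_M p‖ ≤ β ‖P_H p‖}`, where for complementary
subgroups `P_M p = m` and `P_H p = h` are given by the unique factorisation `p = m h`. -/
def HomogeneousNorm.cone (n : HomogeneousNorm C) (M H : Subgroup G) (q : G) (β : ℝ) : Set G :=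
  {p : G | ∃ m ∈ M, ∃ h ∈ H, p = q * (m * h) ∧ n.nrm m ≤ β * n.nrm h}

/-- The intrinsic graph `{m f(m) | m ∈ Ω}` of `f : Ω → H`, `Ω ⊆ M`
(the values of `f` off `Ω` play no role). -/
def intrinsicGraph {G : Type*} [Group G] {M H : Subgroup G} (Ω : Set M) (f : M → H) : Set G :=
  {g : G | ∃ m ∈ Ω, g = (m : G) * (f m : G)}

/-- `f : Ω → H`, `Ω ⊆ M`, is intrinsic Lipschitz: for some `L > 0`, the cone of opening `1 / L`
at each point of the graph meets the graph at its vertex only. -/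
def HomogeneousNorm.IsIntrinsicLipschitz (n : HomogeneousNorm C) {M H : Subgroup G}
    (Ω : Set M) (f : M → H) : Prop :=
  ∃ L : ℝ, 0 < L ∧ ∀ p ∈ intrinsicGraph Ω f, n.cone M H p (1 / L) ∩ intrinsicGraph Ω f = {p}

/-- `S` is an intrinsic `(d_t, d_m)`-Lipschitz graph: the graph of an intrinsic Lipschitz function
`f : Ω → H`, where `G = M · H` for complementary homogeneous subgroups, `M` is a
`(d_t, d_m)`-subgroup and `Ω` is open in `M`. -/
def HomogeneousNorm.IsLipschitzGraph (n : HomogeneousNorm C) (dt dm : ℕ) (S : Set G) : Prop :=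
  ∃ M H : Subgroup G, n.IsDimSubgroup dt dm M ∧ C.IsHomogeneousSubgroup H ∧
    Subgroup.IsComplement' M H ∧
    ∃ (Ω : Set M) (f : M → H), IsOpen Ω ∧ n.IsIntrinsicLipschitz Ω f ∧ S = intrinsicGraph Ω f

/-- `S` is an intrinsic `(d_t, d_m)`-Lipschitz surface: a nonempty set which near each of its points
coincides with an intrinsic `(d_t, d_m)`-Lipschitz graph. -/
def HomogeneousNorm.IsLipschitzSurface (n : HomogeneousNorm C) (dt dm : ℕ) (S : Set G) : Prop :=
  S.Nonempty ∧ ∀ x ∈ S, ∃ U : Set G, IsOpen U ∧ x ∈ U ∧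
    ∃ S' : Set G, n.IsLipschitzGraph dt dm S' ∧ S ∩ U = S' ∩ U

/-- The system of measures `σ_S = 𝒮^{d_m} ⌞ S`, `S ∈ Σ`. -/
def HomogeneousNorm.surfaceMeasures [MeasurableSpace G] [BorelSpace G] (n : HomogeneousNorm C)
    (dm : ℕ) (Sig : Set (Set G)) : Set (Measure G) :=
  (fun S => (n.sphericalMeasure (dm : ℝ)).restrict S) '' Sig

end Metric

end CarnotGroup

/-- Admissible functions of a system `E` of measures. -/
def admissible {X : Type*} [MeasurableSpace X] (E : Set (Measure X)) : Set (X → ℝ) :=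
  {f | Measurable f ∧ (∀ x, 0 ≤ f x) ∧ ∀ σ ∈ E, 1 ≤ ∫⁻ x, ENNReal.ofReal (f x) ∂σ}

/-- The `p`-module `M_p(E)` with respect to the basic measure `μ`; it is `∞` if no function is
admissible. -/
def pModule {X : Type*} [MeasurableSpace X] (μ : Measure X) (p : ℝ) (E : Set (Measure X)) :
    ℝ≥0∞ :=
  ⨅ f ∈ admissible E, ∫⁻ x, ENNReal.ofReal (f x) ^ p ∂μ

end

/-! Write d for `dm` and let f be 2^{dk}/(k+1) on the annulus of points at distance in (2^{-k-1},
2^{-k}] from g₀, so that f behaves like r^{-d}/log(1/r). Balls of radius 2^{-k} have Haar measure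
proportional to 2^{-Qk}, and ∑ 2^{(dp-Q)k} (k+1)^{-p} converges: geometrically if dp < Q, while dp =
Q forces p > 1 because d < Q. So f has finite p-energy. If every surface S through g₀ gives the
punctured ball of radius 2^{-k} measure at least κ 2^{-dk}, then ∫ f dσ_S dominates the harmonic
series and is infinite; all the functions f/(n+1) are then admissible, and their energies tend to 0
(`pModule_eq_zero`).

The lower bound comes from projecting to M with its Haar measure ν. The maps m ↦ P_M(qm) preserve ν
(`measure_preimage_proj_mul`), hence the projection of a ball of radius 2^{-k} has measure c^k V
whatever its centre, c being the factor by which the dilation by 1/2 scales ν. Since M has Hausdorff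
dimension d, counting separated points gives c ≤ 2^{-d} (`mulEquivHaarChar_le`), and a covering
argument bounds ν(P_M(qA)) by a multiple of the spherical measure of A
(`measure_proj_image_le_mkMetric'`). The cone condition at g₀ shows that the part of S within 2^{-k}
of g₀, translated by g₀⁻¹, projects onto a punctured ball of comparable radius
(`exists_mem_graph_of_cone`). The powers c^k on both sides cancel, so c ≥ 2^{-d} is not needed
(`exists_le_mkMetric'_inter`).

The exponent Q is computed in exponential coordinates: left translations have unipotent derivative,
so Lebesgue measure is a Haar measure, and the dilation by t has determinant t^Q
(`mulEquivHaarChar_half`). -/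

noncomputable section

set_option linter.unusedSectionVars false

/-! ### Haar measure and Hausdorff dimension of groups with a halving automorphism. -/

section Halving

open Measure

variable {K : Type*} [Group K] [MetricSpace K] [IsTopologicalGroup K] [IsIsometricSMul K K]
  [ProperSpace K] [MeasurableSpace K] [BorelSpace K]

/-- A topological group automorphism that halves distances. -/
def IsHalving {K : Type*} [Group K] [MetricSpace K] (δ : K ≃ₜ* K) : Prop :=
  ∀ x y, dist (δ x) (δ y) = dist x y / 2

theorem dist_mul_one_le (x y : K) : dist (x * y) 1 ≤ dist x 1 + dist y 1 := by
  have h := dist_triangle (x * y) x 1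
  have h2 : dist (x * y) x = dist y 1 := by
    simpa using dist_smul x y 1
  linarith

theorem dist_inv_one (x : K) : dist x⁻¹ 1 = dist x 1 := by
  have := dist_smul x x⁻¹ 1
  rw [dist_comm x 1]
  simpa using this.symm

theorem dist_inv_mul_one (x y : K) : dist (x⁻¹ * y) 1 = dist y x := by
  have := dist_smul x (x⁻¹ * y) 1
  simpa using this.symm

namespace IsHalving

variable {δ : K ≃ₜ* K}

theorem dist_one (hδ : IsHalving δ) (x : K) : dist (δ x) 1 = dist x 1 / 2 := by
  simpa using hδ x 1

theorem symm_dist_one (hδ : IsHalving δ) (x : K) : dist (δ.symm x) 1 = 2 * dist x 1 := by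
  have := hδ.dist_one (δ.symm x)
  simp only [ContinuousMulEquiv.apply_symm_apply] at this
  linarith

theorem image_closedBall (hδ : IsHalving δ) (R : ℝ) :
    δ '' Metric.closedBall 1 R = Metric.closedBall 1 (R / 2) := by
  ext x
  constructor
  · rintro ⟨y, hy, rfl⟩
    rw [Metric.mem_closedBall] at *
    rw [hδ.dist_one]; linarith
  · intro hx
    refine ⟨δ.symm x, ?_, by simp⟩
    rw [Metric.mem_closedBall] at *
    rw [hδ.symm_dist_one]; linarith

theorem measure_image (δ : K ≃ₜ* K) (ν : Measure K) [ν.IsHaarMeasure] (A : Set K) :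
    ν (δ '' A) = mulEquivHaarChar δ * ν A := by
  rw [← mulEquivHaarChar_smul_preimage ν (X := δ '' A) δ, δ.injective.preimage_image]
  rfl

theorem measure_closedBall_half (hδ : IsHalving δ) (ν : Measure K) [ν.IsHaarMeasure] (R : ℝ) :
    ν (Metric.closedBall 1 (R / 2)) = mulEquivHaarChar δ * ν (Metric.closedBall 1 R) := by
  rw [← hδ.image_closedBall, measure_image]

theorem measure_closedBall_pow (hδ : IsHalving δ) (ν : Measure K) [ν.IsHaarMeasure] (R : ℝ)
    (k : ℕ) : ν (Metric.closedBall 1 (R * (1 / 2) ^ k)) =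
      (mulEquivHaarChar δ : ℝ≥0∞) ^ k * ν (Metric.closedBall 1 R) := by
  induction k with
  | zero => simp
  | succ k ih =>
    rw [show R * (1 / 2) ^ (k + 1) = R * (1 / 2) ^ k / 2 by ring, hδ.measure_closedBall_half, ih]
    ring

theorem measure_closedBall_center (ν : Measure K) [ν.IsHaarMeasure] (x : K) (R : ℝ) :
    ν (Metric.closedBall x R) = ν (Metric.closedBall 1 R) := by
  have h : (fun y => x⁻¹ * y) ⁻¹' Metric.closedBall 1 R = Metric.closedBall x R := by
    ext y
    simp
  rw [← h, measure_preimage_mul]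

/-- Right translation by g⁻¹ moves a ball of radius R ≥ d(g, e) about e into the ball of radius 2R,
whose measure is larger by the factor 1/c only. The bound is uniform in g. -/
theorem modularCharacterFun_le (hδ : IsHalving δ) (g : K) :
    modularCharacterFun g ≤ (mulEquivHaarChar δ)⁻¹ := by
  set ν : Measure K := haar
  obtain ⟨R, hR0, hR⟩ : ∃ R : ℝ, 0 < R ∧ dist g 1 ≤ R := ⟨dist g 1 + 1, by positivity, by linarith⟩
  have h1 : (map (· * g) ν) (Metric.closedBall 1 R) ≤ ν (Metric.closedBall 1 (R * 2)) := by
    rw [map_apply (measurable_mul_const g) measurableSet_closedBall]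
    refine measure_mono fun x hx => ?_
    simp only [mem_preimage, Metric.mem_closedBall] at hx ⊢
    have := dist_mul_one_le (x * g) g⁻¹
    rw [mul_inv_cancel_right, dist_inv_one] at this
    linarith
  rw [map_right_mul_eq_modularCharacterFun_smul] at h1
  have h2 := hδ.measure_closedBall_half ν (R * 2)
  rw [mul_div_assoc, div_self two_ne_zero, mul_one] at h2
  rw [Measure.smul_apply, h2] at h1
  have hpos : ν (Metric.closedBall 1 (R * 2)) ≠ 0 :=
    (Metric.measure_closedBall_pos ν _ (by positivity)).ne'
  have hfin : ν (Metric.closedBall 1 (R * 2)) ≠ ∞ := measure_closedBall_lt_top.ne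
  have hc : mulEquivHaarChar δ ≠ 0 := (mulEquivHaarChar_pos δ).ne'
  rw [ENNReal.smul_def, smul_eq_mul, ← mul_assoc] at h1
  have h3 : ((modularCharacterFun g * mulEquivHaarChar δ : NNReal) : ℝ≥0∞) ≤ 1 := by
    push_cast
    exact (ENNReal.mul_le_mul_iff_left hpos hfin).1 (by simpa using h1)
  rw [inv_eq_one_div, le_div_iff₀ (mulEquivHaarChar_pos δ)]
  exact_mod_cast h3

/-- A bounded homomorphism to the positive reals is trivial: a value above 1 has unbounded powers,
and a value below 1 has an inverse above 1. -/
theorem modularCharacterFun_eq_one (hδ : IsHalving δ) (g : K) : modularCharacterFun g = 1 := by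
  have key : ∀ g : K, modularCharacterFun g ≤ 1 := by
    intro g
    by_contra! hg
    obtain ⟨n, hn⟩ := pow_unbounded_of_one_lt ((mulEquivHaarChar δ)⁻¹) hg
    have h1 := hδ.modularCharacterFun_le (g ^ n)
    have h2 : modularCharacterFun (g ^ n) = modularCharacterFun g ^ n :=
      map_pow (modularCharacter (G := K)) g n
    rw [h2] at h1
    exact absurd h1 (not_le.2 hn)
  refine le_antisymm (key g) ?_
  have h1 : modularCharacterFun g * modularCharacterFun g⁻¹ = 1 := by
    rw [← modularCharacterFun_map_mul, mul_inv_cancel, modularCharacterFun_map_one]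
  calc (1 : NNReal) = modularCharacterFun g * modularCharacterFun g⁻¹ := h1.symm
    _ ≤ modularCharacterFun g * 1 := by gcongr; exact key _
    _ = _ := mul_one _

theorem isMulRightInvariant (hδ : IsHalving δ) (ν : Measure K) [ν.IsHaarMeasure] :
    ν.IsMulRightInvariant where
  map_mul_right_eq_self g := by
    rw [map_right_mul_eq_modularCharacterFun_smul, hδ.modularCharacterFun_eq_one, one_smul]

/-- A separated subset of a ball has few points. -/
theorem encard_mul_le (hδ : IsHalving δ) (ν : Measure K) [ν.IsHaarMeasure] {R : ℝ} (k : ℕ)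
    {C : Set K} (hC : C ⊆ Metric.closedBall 1 R)
    (hsep : Metric.IsSeparated (((1 / 2) ^ k : NNReal) : ℝ≥0∞) C) :
    (C.encard : ℝ≥0∞) * ((mulEquivHaarChar δ : ℝ≥0∞) ^ (k + 2) * ν (Metric.closedBall 1 1)) ≤
      ν (Metric.closedBall 1 (R + 1)) := by
  have hr : ((1 / 2 : ℝ) ^ (k + 2)) ≤ 1 := pow_le_one₀ (by norm_num) (by norm_num)
  -- A quarter of the separation keeps the closed balls disjoint, and as a power of 1/2 it is a
  -- radius at which the measure of a ball is known exactly.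
  have hdisj : C.PairwiseDisjoint fun x => Metric.closedBall x ((1 / 2 : ℝ) ^ (k + 2)) := by
    intro x hx y hy hxy
    have h : (((1 / 2) ^ k : NNReal) : ℝ≥0∞) < edist x y := hsep hx hy hxy
    rw [edist_nndist, ENNReal.coe_lt_coe] at h
    have h' : ((1 / 2 : ℝ)) ^ k < dist x y := by
      rw [← coe_nndist]; exact_mod_cast h
    apply Metric.closedBall_disjoint_closedBall
    have : (0 : ℝ) < (1 / 2) ^ k := by positivity
    have h4 : (1 / 2 : ℝ) ^ (k + 2) = (1 / 2) ^ k / 4 := by rw [pow_add]; norm_num; ring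
    rw [h4]; linarith
  have hcount : C.Countable := by
    refine hdisj.countable_of_nonempty_interior fun x hx => ?_
    exact ⟨x, Metric.ball_subset_interior_closedBall (Metric.mem_ball_self (by positivity))⟩
  have hsub : (⋃ x ∈ C, Metric.closedBall x ((1 / 2 : ℝ) ^ (k + 2))) ⊆
      Metric.closedBall 1 (R + 1) := by
    refine iUnion₂_subset fun x hx y hy => ?_
    have h1 := hC hx
    rw [Metric.mem_closedBall] at *
    linarith [dist_triangle y x 1]
  calc _ = ∑' _ : C, ((mulEquivHaarChar δ : ℝ≥0∞) ^ (k + 2) * ν (Metric.closedBall 1 1)) := by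
        rw [ENNReal.tsum_const, ENat.card_coe_set_eq]
    _ = ∑' x : C, ν (Metric.closedBall (x : K) ((1 / 2 : ℝ) ^ (k + 2))) := by
        refine tsum_congr fun x => ?_
        rw [measure_closedBall_center ν (x : K), ← hδ.measure_closedBall_pow, one_mul]
    _ = ν (⋃ x ∈ C, Metric.closedBall x ((1 / 2 : ℝ) ^ (k + 2))) :=
        (measure_biUnion hcount hdisj fun x _ => measurableSet_closedBall).symm
    _ ≤ _ := measure_mono hsub

/-- Finiteness is what makes `Metric.maximalSeparatedSet` a cover. -/
theorem packingNumber_ne_top (hδ : IsHalving δ) (R : ℝ) (k : ℕ) :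
    Metric.packingNumber ((1 / 2) ^ k) (Metric.closedBall (1 : K) R) ≠ ⊤ := by
  set ν : Measure K := haar
  set a : ℝ≥0∞ := (mulEquivHaarChar δ : ℝ≥0∞) ^ (k + 2) * ν (Metric.closedBall 1 1)
  have ha : a ≠ 0 := mul_ne_zero (pow_ne_zero _ (by simpa using (mulEquivHaarChar_pos δ).ne'))
    (Metric.measure_closedBall_pos ν _ one_pos).ne'
  have hfin : ν (Metric.closedBall 1 (R + 1)) / a ≠ ∞ :=
    ENNReal.div_ne_top measure_closedBall_lt_top.ne ha
  obtain ⟨N, hN⟩ := ENNReal.exists_nat_gt hfin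
  refine ne_top_of_le_ne_top (ENat.natCast_ne_top N) ?_
  refine iSup_le fun C => iSup_le fun hC => iSup_le fun hsep => ?_
  have h1 := hδ.encard_mul_le ν k hC (by simpa using hsep)
  have h2 := (ENNReal.le_div_iff_mul_le (Or.inl ha) (Or.inr measure_closedBall_lt_top.ne)).2 h1
  have h3 : ((C.encard : ℕ∞) : ℝ≥0∞) ≤ ((N : ℕ∞) : ℝ≥0∞) := by
    simpa using h2.trans hN.le
  exact ENat.toENNReal_le.1 h3

/-- A maximal 2^{-k}-separated set in a ball has at most a constant times c^{-k} points, and c^{-k}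
≤ 2^{ks}. The balls of radius 2^{-k} about them cover, with sums of diam^s bounded independently of
k. -/
theorem dimH_univ_le (hδ : IsHalving δ) (s : NNReal)
    (hs : (1 / 2 : NNReal) ^ (s : ℝ) ≤ mulEquivHaarChar δ) :
    dimH (univ : Set K) ≤ s := by
  set ν : Measure K := haar
  set c : NNReal := mulEquivHaarChar δ
  have hc : (c : ℝ≥0∞) ≠ 0 := by simpa using (mulEquivHaarChar_pos δ).ne'
  have hcover : (univ : Set K) = ⋃ n : ℕ, Metric.closedBall 1 (n : ℝ) :=
    (Metric.iUnion_closedBall_nat 1).symm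
  rw [hcover, dimH_iUnion]
  refine iSup_le fun n => dimH_le_of_hausdorffMeasure_ne_top ?_
  set V := ν (Metric.closedBall 1 1)
  have hV0 : V ≠ 0 := (Metric.measure_closedBall_pos ν _ one_pos).ne'
  have hVt : V ≠ ∞ := measure_closedBall_lt_top.ne
  set W := ν (Metric.closedBall 1 ((n : ℝ) + 1))
  have hWt : W ≠ ∞ := measure_closedBall_lt_top.ne
  set C : ℕ → Set K := fun k =>
    Metric.maximalSeparatedSet ((1 / 2) ^ k) (Metric.closedBall 1 (n : ℝ))
  have hCsub : ∀ k, C k ⊆ Metric.closedBall 1 (n : ℝ) := fun k =>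
    Metric.maximalSeparatedSet_subset
  have hCsep : ∀ k, Metric.IsSeparated (((1 / 2) ^ k : NNReal) : ℝ≥0∞) (C k) := fun k =>
    Metric.isSeparated_maximalSeparatedSet
  have hcard := fun k => hδ.encard_mul_le ν k (hCsub k) (hCsep k)
  have hcount : ∀ k, Countable (C k) := by
    intro k
    refine (Set.encard_ne_top_iff.1 ?_).countable
    exact ne_top_of_le_ne_top (hδ.packingNumber_ne_top n k)
      ((hCsep k).encard_le_packingNumber (hCsub k))
  set B : ℝ≥0∞ := 2 ^ (s : ℝ) * (W / (c ^ 2 * V))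
  have hB : B ≠ ∞ := ENNReal.mul_ne_top (by simp)
    (ENNReal.div_ne_top hWt (mul_ne_zero (pow_ne_zero _ hc) hV0))
  have hdiam : ∀ k (x : K), Metric.ediam (Metric.closedBall x ((1 / 2 : ℝ) ^ k)) ≤
      2 * (1 / 2 : ℝ≥0∞) ^ k := by
    intro k x
    rw [← Metric.closedEBall_ofReal (by positivity)]
    refine Metric.ediam_closedEBall_le.trans_eq ?_
    rw [ENNReal.ofReal_pow (by norm_num), ENNReal.ofReal_div_of_pos two_pos]
    simp
  have hbound : ∀ k, ∑' x : C k, Metric.ediam (Metric.closedBall (x : K) ((1 / 2 : ℝ) ^ k)) ^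
      (s : ℝ) ≤ B := by
    intro k
    have hck : ((1 / 2 : ℝ≥0∞) ^ k) ^ (s : ℝ) ≤ (c : ℝ≥0∞) ^ k := by
      have h1 : ((1 / 2 : NNReal) ^ (s : ℝ)) ^ k ≤ c ^ k := by gcongr
      have h2 : ((1 / 2 : NNReal) ^ (s : ℝ)) ^ k = ((1 / 2 : NNReal) ^ k) ^ (s : ℝ) := by
        rw [← NNReal.rpow_natCast, ← NNReal.rpow_natCast, ← NNReal.rpow_mul, ← NNReal.rpow_mul,
          mul_comm]
      rw [h2] at h1
      have h3 := ENNReal.coe_le_coe.2 h1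
      rw [ENNReal.coe_rpow_of_nonneg _ s.coe_nonneg] at h3
      simpa [ENNReal.inv_pow] using h3
    calc _ ≤ ∑' _ : C k, (2 * (1 / 2 : ℝ≥0∞) ^ k) ^ (s : ℝ) :=
          ENNReal.tsum_le_tsum fun x => ENNReal.rpow_le_rpow (hdiam k x) s.coe_nonneg
      _ = ((C k).encard : ℝ≥0∞) * (2 ^ (s : ℝ) * ((1 / 2 : ℝ≥0∞) ^ k) ^ (s : ℝ)) := by
          rw [ENNReal.tsum_const, ENat.card_coe_set_eq, ENNReal.mul_rpow_of_nonneg _ _ s.coe_nonneg]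
      _ ≤ ((C k).encard : ℝ≥0∞) * (2 ^ (s : ℝ) * (c : ℝ≥0∞) ^ k) := by gcongr
      _ = 2 ^ (s : ℝ) * (((C k).encard : ℝ≥0∞) * (c : ℝ≥0∞) ^ k) := by ring
      _ ≤ B := by
          refine mul_le_mul_right ?_ _
          rw [ENNReal.le_div_iff_mul_le (Or.inl (mul_ne_zero (pow_ne_zero _ hc) hV0))
            (Or.inr hWt)]
          refine le_of_eq_of_le ?_ (hcard k)
          rw [pow_add]; ring
  have key := hausdorffMeasure_le_liminf_tsum (s : ℝ) (Metric.closedBall (1 : K) (n : ℝ))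
    (l := atTop) (fun k : ℕ => 2 * (1 / 2 : ℝ≥0∞) ^ k) ?_
    (fun k (x : C k) => Metric.closedBall (x : K) ((1 / 2 : ℝ) ^ k))
    (Eventually.of_forall fun k x => hdiam k x) (Eventually.of_forall fun k => ?_)
  · refine ne_top_of_le_ne_top hB (key.trans ?_)
    exact liminf_le_of_le (by isBoundedDefault) fun b hb => by
      obtain ⟨k, hk⟩ := hb.exists
      exact hk.trans (hbound k)
  · have := ENNReal.Tendsto.const_mul (a := 2)
      (ENNReal.tendsto_pow_atTop_nhds_zero_of_lt_one (r := 1 / 2) (by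
        simp)) (Or.inr (by simp))
    rwa [mul_zero] at this
  · intro x hx
    have hcov := Metric.isCover_maximalSeparatedSet (hδ.packingNumber_ne_top n k)
    obtain ⟨y, hy, hxy⟩ := hcov hx
    refine mem_iUnion.2 ⟨⟨y, hy⟩, ?_⟩
    have hxy' : edist x y ≤ (((1 / 2) ^ k : NNReal) : ℝ≥0∞) := hxy
    rw [edist_nndist, ENNReal.coe_le_coe] at hxy'
    rw [Metric.mem_closedBall, ← coe_nndist]
    exact_mod_cast hxy'

/-- If c > 2^{-d}, continuity gives s < d with 2^{-s} ≤ c, and then the dimension is at most s. -/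
theorem mulEquivHaarChar_le (hδ : IsHalving δ) {d : ℕ} (hd : d ≠ 0)
    (h : dimH (univ : Set K) = d) : mulEquivHaarChar δ ≤ (1 / 2) ^ d := by
  by_contra! hlt
  have hcont : ContinuousAt (fun s : ℝ => (1 / 2 : ℝ) ^ s) (d : ℝ) :=
    Real.continuousAt_const_rpow (by norm_num)
  have hlt' : (fun s : ℝ => (1 / 2 : ℝ) ^ s) (d : ℝ) < mulEquivHaarChar δ := by
    rw [← NNReal.coe_lt_coe] at hlt
    simpa using hlt
  have h1 := (hcont.eventually_lt continuousAt_const hlt').filter_mono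
    (nhdsWithin_le_nhds (s := Iio (d : ℝ)))
  have h2 : ∀ᶠ s in 𝓝[<] (d : ℝ), 0 < s :=
    (lt_mem_nhds (show (0 : ℝ) < d by positivity)).filter_mono nhdsWithin_le_nhds
  obtain ⟨s, ⟨hs1, hs2⟩, hs3⟩ := ((h1.and h2).and self_mem_nhdsWithin).exists
  lift s to NNReal using hs2.le
  have h3 := hδ.dimH_univ_le s (by
    rw [← NNReal.coe_le_coe]
    simpa using hs1.le)
  rw [h] at h3
  have h4 : (d : NNReal) ≤ s := by
    rw [← ENNReal.coe_le_coe]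
    simpa using h3
  have h5 : (s : ℝ) < d := hs3
  exact absurd h4 (not_le.2 (by exact_mod_cast h5))

end IsHalving

end Halving

/-! ### Projections along complementary subgroups and the invariance of Haar measure. -/

section Complement

open Measure

variable {G : Type*} [Group G] [MetricSpace G] [IsTopologicalGroup G] [IsIsometricSMul G G]
  [ProperSpace G] [MeasurableSpace G] [BorelSpace G]

instance Subgroup.isIsometricSMul_self (M : Subgroup G) : IsIsometricSMul M M :=
  ⟨fun m x y => edist_smul_left (m : G) (x : G) (y : G)⟩

/-- The restriction of a topological automorphism to an invariant subgroup. -/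
def ContinuousMulEquiv.restrictSubgroup (δ : G ≃ₜ* G) (M : Subgroup G)
    (h : ∀ g, δ g ∈ M ↔ g ∈ M) : M ≃ₜ* M where
  toFun m := ⟨δ m, (h m).2 m.2⟩
  invFun m := ⟨δ.symm m, (h _).1 (by simp)⟩
  left_inv m := by ext; simp
  right_inv m := by ext; simp
  map_mul' a b := by ext; simp
  continuous_toFun := by fun_prop
  continuous_invFun := by fun_prop

@[simp] theorem ContinuousMulEquiv.coe_restrictSubgroup (δ : G ≃ₜ* G) (M : Subgroup G)
    (h : ∀ g, δ g ∈ M ↔ g ∈ M) (m : M) : (δ.restrictSubgroup M h m : G) = δ m := rfl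

theorem IsHalving.restrictSubgroup {δ : G ≃ₜ* G} (hδ : IsHalving δ) (M : Subgroup G)
    (h : ∀ g, δ g ∈ M ↔ g ∈ M) : IsHalving (δ.restrictSubgroup M h) :=
  fun x y => hδ x y

namespace Subgroup.IsComplement'

variable {M H : Subgroup G} (hMH : Subgroup.IsComplement' M H)

/-- The projection `P_M` onto the first of two complementary subgroups. -/
def proj (g : G) : M := (hMH.equiv g).1

/-- The projection `P_H` onto the second of two complementary subgroups. -/
def projSnd (g : G) : H := (hMH.equiv g).2

theorem proj_mul_projSnd (g : G) : (hMH.proj g : G) * hMH.projSnd g = g :=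
  hMH.equiv_fst_mul_equiv_snd g

theorem equiv_mul (m : M) (h : H) : hMH.equiv ((m : G) * h) = (m, h) :=
  hMH.equiv.apply_symm_apply (m, h)

theorem proj_mul (m : M) (h : H) : hMH.proj ((m : G) * h) = m := by
  rw [proj, equiv_mul]

theorem projSnd_mul (m : M) (h : H) : hMH.projSnd ((m : G) * h) = h := by
  rw [projSnd, equiv_mul]

theorem proj_coe (m : M) : hMH.proj (m : G) = m := by
  simpa using hMH.proj_mul m 1

theorem proj_mul_right (g : G) (h : H) : hMH.proj (g * h) = hMH.proj g := by
  rw [← hMH.proj_mul_projSnd g, mul_assoc, ← Subgroup.coe_mul, proj_mul, proj_mul]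

/-- P_M ignores right factors in H, so m ↦ P_M(qm) is the action of G on G/H read on the section M.
-/
theorem proj_mul_proj (q g : G) : hMH.proj (q * hMH.proj g) = hMH.proj (q * g) := by
  conv_rhs => rw [← hMH.proj_mul_projSnd g, ← mul_assoc, proj_mul_right]

theorem proj_map (δ : G ≃ₜ* G) (hM : ∀ g, δ g ∈ M ↔ g ∈ M) (hH : ∀ g, δ g ∈ H ↔ g ∈ H) (g : G) :
    hMH.proj (δ g) = δ.restrictSubgroup M hM (hMH.proj g) := by
  conv_lhs => rw [← hMH.proj_mul_projSnd g, map_mul]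
  exact hMH.proj_mul (δ.restrictSubgroup M hM (hMH.proj g))
    (δ.restrictSubgroup H hH (hMH.projSnd g))

/-- The factorisation `(m, h) ↦ m h⁻¹` as a homeomorphism. -/
theorem exists_homeomorph (hMH : Subgroup.IsComplement' M H)
    (hM : IsClosed (M : Set G)) (hH : IsClosed (H : Set G)) :
    ∃ e : M × H ≃ₜ G, ∀ p, e p = (p.1 : G) * (p.2 : G)⁻¹ := by
  -- The inverse on the H factor makes the factorisation an orbit map of M × H acting by m g h⁻¹.
  -- The action is transitive, so the open mapping theorem for σ-compact groups makes this bijection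
  -- a homeomorphism.
  let act : MulAction (M × H) G :=
    { smul := fun p g => (p.1 : G) * g * (p.2 : G)⁻¹
      one_smul := fun g => by change ((1 : M) : G) * g * ((1 : H) : G)⁻¹ = g; simp
      mul_smul := fun p q g => by
        change ((p.1 * q.1 : M) : G) * g * ((p.2 * q.2 : H) : G)⁻¹ =
          (p.1 : G) * ((q.1 : G) * g * (q.2 : G)⁻¹) * (p.2 : G)⁻¹
        push_cast
        group }
  have hsmul : ∀ (p : M × H) (g : G), p • g = (p.1 : G) * g * (p.2 : G)⁻¹ := fun _ _ => rfl
  have : ContinuousSMul (M × H) G := ⟨by simp only [hsmul]; fun_prop⟩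
  have hsurj : ∀ g : G, ∃ p : M × H, p • (1 : G) = g := fun g =>
    ⟨(hMH.proj g, (hMH.projSnd g)⁻¹), by
      rw [hsmul]; simpa using hMH.proj_mul_projSnd g⟩
  have : MulAction.IsPretransitive (M × H) G :=
    ⟨fun x y => by
    obtain ⟨p, rfl⟩ := hsurj x
    obtain ⟨q, rfl⟩ := hsurj y
    exact ⟨q * p⁻¹, by rw [smul_smul, inv_mul_cancel_right]⟩⟩
  have := hM.isClosedEmbedding_subtypeVal.sigmaCompactSpace
  have := hH.isClosedEmbedding_subtypeVal.sigmaCompactSpace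
  have hopen := isOpenMap_smul_of_sigmaCompact (G := M × H) (1 : G)
  have hinj : Function.Injective fun p : M × H => p • (1 : G) := by
    intro p q hpq
    simp only [hsmul, mul_one] at hpq
    have h1 := congrArg hMH.equiv
      (show (p.1 : G) * ((p.2⁻¹ : H) : G) = q.1 * ((q.2⁻¹ : H) : G) by simpa using hpq)
    rw [equiv_mul, equiv_mul, Prod.mk.injEq] at h1
    exact Prod.ext h1.1 (inv_injective h1.2)
  have hcont : Continuous fun p : M × H => p • (1 : G) := by fun_prop
  refine ⟨(Equiv.ofBijective _ ⟨hinj, hsurj⟩).toHomeomorphOfContinuousOpen hcont hopen,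
    fun p => ?_⟩
  change p • (1 : G) = _
  rw [hsmul, mul_one]

theorem continuous_proj (hM : IsClosed (M : Set G)) (hH : IsClosed (H : Set G)) :
    Continuous hMH.proj := by
  obtain ⟨e, he⟩ := hMH.exists_homeomorph hM hH
  have : hMH.proj = fun g => (e.symm g).1 := by
    funext g
    conv_lhs => rw [← e.apply_symm_apply g, he, ← Subgroup.coe_inv, proj_mul]
  rw [this]
  fun_prop

theorem continuous_projSnd (hM : IsClosed (M : Set G)) (hH : IsClosed (H : Set G)) :
    Continuous hMH.projSnd := by
  obtain ⟨e, he⟩ := hMH.exists_homeomorph hM hH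
  have : hMH.projSnd = fun g => (e.symm g).2⁻¹ := by
    funext g
    conv_lhs => rw [← e.apply_symm_apply g, he, ← Subgroup.coe_inv, projSnd_mul]
  rw [this]
  fun_prop

variable {δ : G ≃ₜ* G}

/-- The maps `m ↦ P_M (q m)` preserve the Haar measure of `M`. -/
theorem measure_preimage_proj_mul (hδ : IsHalving δ)
    (hM : IsClosed (M : Set G)) (hH : IsClosed (H : Set G))
    (hδH : ∀ g, δ g ∈ H ↔ g ∈ H) (ν : Measure M) [ν.IsHaarMeasure] (q : G)
    {E : Set M} (hE : MeasurableSet E) :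
    ν ((fun m : M => hMH.proj (q * m)) ⁻¹' E) = ν E := by
  have : ProperSpace M := ProperSpace.of_isClosed hM
  have : ProperSpace H := ProperSpace.of_isClosed hH
  obtain ⟨e, he⟩ := hMH.exists_homeomorph hM hH
  set μ : Measure G := haar
  have : μ.IsMulRightInvariant := hδ.isMulRightInvariant μ
  set η : Measure H := haar
  have : η.IsMulRightInvariant := (hδ.restrictSubgroup H hδH).isMulRightInvariant η
  -- G is unimodular, so μ is invariant under g ↦ m g h⁻¹. In the coordinates `e` it is therefore
  -- left invariant on M × H, hence a multiple of ν × η.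
  set lam : Measure (M × H) := Measure.map e.symm μ
  have hlam : ∀ A, MeasurableSet A → lam A = μ (e.symm ⁻¹' A) := fun A hA =>
    Measure.map_apply e.symm.continuous.measurable hA
  have : lam.IsMulLeftInvariant := by
    refine ⟨fun p => ?_⟩
    ext A hA
    rw [Measure.map_apply (measurable_const_mul p) hA, hlam _ (measurable_const_mul p hA), hlam _ hA]
    have h1 : e.symm ⁻¹' ((fun x => p * x) ⁻¹' A) =
        (fun g => (p.1 : G) * g) ⁻¹' ((fun g => g * (p.2 : G)⁻¹) ⁻¹' (e.symm ⁻¹' A)) := by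
      ext g
      obtain ⟨x, rfl⟩ := e.surjective g
      have h2 : (p.1 : G) * e x * (p.2 : G)⁻¹ = e (p * x) := by
        simp only [he, Prod.fst_mul, Prod.snd_mul, Subgroup.coe_mul]
        group
      simp only [mem_preimage, h2, e.symm_apply_apply]
    rw [h1, measure_preimage_mul, measure_preimage_mul_right]
  have : IsFiniteMeasureOnCompacts lam := by
    refine ⟨fun A hA => ?_⟩
    rw [hlam A hA.measurableSet, ← e.image_eq_preimage_symm]
    exact (hA.image e.continuous).measure_lt_top
  set κ : NNReal := haarScalarFactor lam (ν.prod η)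
  have hκ : lam = κ • ν.prod η := isMulLeftInvariant_eq_smul _ _
  set B : Set H := Metric.closedBall 1 1
  have hB : MeasurableSet B := measurableSet_closedBall
  have hB0 : η B ≠ 0 := (Metric.measure_closedBall_pos η _ one_pos).ne'
  have hBt : η B ≠ ∞ := measure_closedBall_lt_top.ne
  have hκ0 : (κ : ℝ≥0∞) ≠ 0 := by
    intro h0
    have h1 : lam univ = 0 := by rw [hκ]; simp [ENNReal.smul_def, h0]
    rw [hlam _ MeasurableSet.univ, preimage_univ] at h1
    exact (measure_univ_ne_zero.2 (NeZero.ne μ)) h1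
  have hc1 := hMH.continuous_proj hM hH
  have hc2 := hMH.continuous_projSnd hM hH
  set τ : M → M := fun m => hMH.proj (q * m)
  have hτ : Continuous τ := by fun_prop
  -- In the coordinates `e`, left multiplication by q is the skew product (m, h) ↦ (τ m, h
  -- P_H(qm)⁻¹), and D is the preimage of E × B. Fubini and right invariance of η evaluate its
  -- measure as ν(τ⁻¹E) η(B); the factor η(B) then cancels.
  set D : Set (M × H) := {p | τ p.1 ∈ E ∧ p.2 * (hMH.projSnd (q * p.1))⁻¹ ∈ B}
  have hD : MeasurableSet D := by
    refine ((hτ.comp continuous_fst).measurable hE).inter ?_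
    have : Continuous fun p : M × H => p.2 * (hMH.projSnd (q * p.1))⁻¹ := by fun_prop
    exact this.measurable hB
  have h1 : lam D = lam (E ×ˢ B) := by
    rw [hlam _ hD, hlam _ (hE.prod hB)]
    rw [← measure_preimage_mul μ q (e.symm ⁻¹' (E ×ˢ B))]
    congr 1
    ext g
    obtain ⟨⟨m, h⟩, rfl⟩ := e.surjective g
    have h2 : q * e (m, h) = e (τ m, h * (hMH.projSnd (q * m))⁻¹) := by
      rw [he, he]
      simp only [Subgroup.coe_mul, Subgroup.coe_inv, mul_inv_rev, inv_inv, ← mul_assoc, τ]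
      rw [hMH.proj_mul_projSnd]
    simp only [mem_preimage, h2, e.symm_apply_apply]
    rfl
  have h2 : (ν.prod η) D = ν (τ ⁻¹' E) * η B := by
    rw [prod_apply hD]
    have h3 : ∀ m, η (Prod.mk m ⁻¹' D) = (τ ⁻¹' E).indicator (fun _ => η B) m := by
      intro m
      by_cases hm : τ m ∈ E
      · rw [indicator_of_mem (by exact hm)]
        rw [← measure_preimage_mul_right η (hMH.projSnd (q * m))⁻¹ B]
        congr 1
        ext h
        simp [D, hm]
      · rw [indicator_of_notMem (by exact hm)]
        have : Prod.mk m ⁻¹' D = ∅ := by ext h; simp [D, hm]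
        rw [this, measure_empty]
    simp only [h3]
    rw [lintegral_indicator (hτ.measurable hE), setLIntegral_const, mul_comm]
  rw [hκ, Measure.smul_apply, Measure.smul_apply, h2, prod_prod, ENNReal.smul_def, ENNReal.smul_def,
    smul_eq_mul, smul_eq_mul] at h1
  have h3 := (ENNReal.mul_right_inj hκ0 ENNReal.coe_ne_top).1 h1
  exact (ENNReal.mul_left_inj hB0 hBt).1 h3

end Subgroup.IsComplement'

end Complement

/-! ### Lower bounds for the measure of a set through its projection. -/

section Graph

open Measure

variable {G : Type*} [Group G] [MetricSpace G] [IsTopologicalGroup G] [IsIsometricSMul G G]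
  [ProperSpace G] [MeasurableSpace G] [BorelSpace G]

namespace Subgroup.IsComplement'

variable {M H : Subgroup G} (hMH : Subgroup.IsComplement' M H) {δ : G ≃ₜ* G}

theorem proj_image_closedBall (x : G) (R : ℝ) :
    hMH.proj '' Metric.closedBall x R =
      (fun m : M => hMH.proj (x⁻¹ * m)) ⁻¹' (hMH.proj '' Metric.closedBall 1 R) := by
  ext m
  constructor
  · rintro ⟨g, hg, rfl⟩
    refine ⟨x⁻¹ * g, ?_, (hMH.proj_mul_proj x⁻¹ g).symm⟩
    rwa [Metric.mem_closedBall, dist_inv_mul_one]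
  · rintro ⟨b, hb, hbm⟩
    refine ⟨x * b, ?_, ?_⟩
    · rw [Metric.mem_closedBall, ← dist_inv_mul_one, inv_mul_cancel_left]
      exact hb
    · rw [← hMH.proj_mul_proj x b, hbm, hMH.proj_mul_proj, mul_inv_cancel_left, hMH.proj_coe]

/-- Moving the centre of a ball replaces its projection by a preimage under a ν-preserving map. At
the identity, projection commutes with halving. -/
theorem measure_proj_image_closedBall (hδ : IsHalving δ)
    (hM : IsClosed (M : Set G)) (hH : IsClosed (H : Set G))
    (hδM : ∀ g, δ g ∈ M ↔ g ∈ M) (hδH : ∀ g, δ g ∈ H ↔ g ∈ H)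
    [ProperSpace M] (ν : Measure M) [ν.IsHaarMeasure] (x : G) (k : ℕ) :
    ν (hMH.proj '' Metric.closedBall x ((1 / 2) ^ k)) =
      (mulEquivHaarChar (δ.restrictSubgroup M hδM) : ℝ≥0∞) ^ k *
        ν (hMH.proj '' Metric.closedBall 1 1) := by
  have hmeas : ∀ R, MeasurableSet (hMH.proj '' Metric.closedBall 1 R) := fun R =>
    ((isCompact_closedBall 1 R).image (hMH.continuous_proj hM hH)).measurableSet
  rw [proj_image_closedBall, hMH.measure_preimage_proj_mul hδ hM hH hδH ν _ (hmeas _)]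
  induction k with
  | zero => simp
  | succ k ih =>
    have h1 : hMH.proj '' Metric.closedBall 1 ((1 / 2) ^ (k + 1)) =
        δ.restrictSubgroup M hδM '' (hMH.proj '' Metric.closedBall 1 ((1 / 2) ^ k)) := by
      rw [show ((1 / 2 : ℝ)) ^ (k + 1) = (1 / 2) ^ k / 2 by ring, ← hδ.image_closedBall,
        image_image, image_image]
      exact image_congr fun g _ => hMH.proj_map δ hδM hδH g
    rw [h1, IsHalving.measure_image, ih, pow_succ]
    ring

/-- Projections of small sets have small measure. -/
theorem measure_proj_image_le (hδ : IsHalving δ)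
    (hM : IsClosed (M : Set G)) (hH : IsClosed (H : Set G))
    (hδM : ∀ g, δ g ∈ M ↔ g ∈ M) (hδH : ∀ g, δ g ∈ H ↔ g ∈ H)
    [ProperSpace M] (ν : Measure M) [ν.IsHaarMeasure] {d : ℕ} (hd : d ≠ 0)
    (hc : mulEquivHaarChar (δ.restrictSubgroup M hδM) ≤ (1 / 2) ^ d) (q : G) (k : ℕ)
    {s : Set G} (hs : Metric.ediam s ≤ (1 / 2) ^ k) :
    ν ((fun g => hMH.proj (q * g)) '' s) ≤
      (mulEquivHaarChar (δ.restrictSubgroup M hδM) : ℝ≥0∞) ^ k *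
        ν (hMH.proj '' Metric.closedBall 1 1) * 2 ^ (d * (k + 1)) * Metric.ediam s ^ d := by
  set c : ℝ≥0∞ := (mulEquivHaarChar (δ.restrictSubgroup M hδM) : ℝ≥0∞)
  set V := ν (hMH.proj '' Metric.closedBall 1 1)
  have hVt : V ≠ ∞ :=
    ((isCompact_closedBall 1 1).image (hMH.continuous_proj hM hH)).measure_lt_top.ne
  have hc' : c ≤ (1 / 2) ^ d := by
    have := ENNReal.coe_le_coe.2 hc
    simpa [ENNReal.inv_pow] using this
  rcases s.eq_empty_or_nonempty with rfl | ⟨x, hx⟩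
  · simp
  have hj : ∀ j : ℕ, Metric.ediam s ≤ (1 / 2) ^ j →
      ν ((fun g => hMH.proj (q * g)) '' s) ≤ c ^ j * V := by
    intro j hj
    rw [← hMH.measure_proj_image_closedBall hδ hM hH hδM hδH ν (q * x) j]
    refine measure_mono ?_
    rintro _ ⟨y, hy, rfl⟩
    refine ⟨q * y, ?_, rfl⟩
    have h1 : edist y x ≤ (1 / 2) ^ j := (Metric.edist_le_ediam_of_mem hy hx).trans hj
    have h2 : dist (q * y) (q * x) = dist y x := dist_smul q y x
    rw [Metric.mem_closedBall, h2]
    have h3 : ((1 / 2 : ℝ≥0∞)) ^ j = ENNReal.ofReal ((1 / 2) ^ j) := by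
      rw [ENNReal.ofReal_pow (by norm_num), ENNReal.ofReal_div_of_pos two_pos]
      simp
    rw [h3, edist_dist] at h1
    exact (ENNReal.ofReal_le_ofReal_iff (by positivity)).1 h1
  -- For diameter zero the bounds c^j V hold for all j and tend to 0. Otherwise j is chosen with
  -- 2^{-j-1} < diam ≤ 2^{-j}.
  by_cases h0 : Metric.ediam s = 0
  · have hc1 : c < 1 := hc'.trans_lt (pow_lt_one₀ (by simp) (by simp) hd)
    have hlim : Tendsto (fun j => c ^ j * V) atTop (𝓝 (0 * V)) :=
      ENNReal.Tendsto.mul_const (ENNReal.tendsto_pow_atTop_nhds_zero_of_lt_one hc1) (Or.inr hVt)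
    rw [zero_mul] at hlim
    have : ν ((fun g => hMH.proj (q * g)) '' s) ≤ 0 :=
      ge_of_tendsto' hlim fun j => hj j (by rw [h0]; exact zero_le)
    exact this.trans zero_le
  · have hk1 : ((1 / 2 : ℝ≥0∞)) ^ k ≤ 1 := pow_le_one₀ (by simp) (by simp)
    have htop : Metric.ediam s ≠ ∞ := ne_top_of_le_ne_top (by simp) (hs.trans hk1)
    obtain ⟨ρ, hρ⟩ : ∃ ρ : NNReal, (ρ : ℝ≥0∞) = Metric.ediam s := ⟨_, ENNReal.coe_toNNReal htop⟩
    have hpow : ∀ j : ℕ, ((1 / 2 : ℝ≥0∞)) ^ j = (((1 / 2) ^ j : NNReal) : ℝ≥0∞) := by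
      intro j; simp [ENNReal.inv_pow]
    have hρ0 : 0 < ρ := by
      rw [pos_iff_ne_zero]; rintro rfl; exact h0 (by rw [← hρ]; simp)
    have hρk : ρ ≤ (1 / 2) ^ k := by
      rw [← hρ, hpow] at hs; exact_mod_cast hs
    obtain ⟨j, hj1, hj2⟩ := exists_nat_pow_near_of_lt_one hρ0
      (hρk.trans (pow_le_one₀ (by norm_num) (by norm_num))) (y := 1 / 2) (by norm_num)
      (by rw [← NNReal.coe_lt_coe]; norm_num)
    have hkj : k ≤ j := by
      have h1 := hj1.trans_le hρk
      rw [pow_lt_pow_iff_right_of_lt_one₀ (by norm_num)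
        (by rw [← NNReal.coe_lt_coe]; norm_num)] at h1
      omega
    obtain ⟨i, rfl⟩ := Nat.exists_eq_add_of_le hkj
    refine (hj (k + i) (by rw [← hρ, hpow]; exact_mod_cast hj2)).trans ?_
    have h2 : ((1 / 2 : ℝ≥0∞)) ^ (k + i + 1) ≤ Metric.ediam s := by
      rw [← hρ, hpow]; exact_mod_cast hj1.le
    -- The bound c ≤ 2^{-d} is spent only on the i scales below 2^{-k}; the factor c^k is kept, to
    -- cancel later.
    have h3 : c ^ i ≤ 2 ^ (d * (k + 1)) * Metric.ediam s ^ d := by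
      calc c ^ i ≤ ((1 / 2) ^ d) ^ i := by gcongr
        _ = 2 ^ (d * (k + 1)) * ((1 / 2 : ℝ≥0∞) ^ (k + i + 1)) ^ d := by
          rw [← pow_mul, ← pow_mul, show (k + i + 1) * d = d * (k + 1) + d * i by ring, pow_add,
            ← mul_assoc, ← mul_pow]
          rw [one_div, ENNReal.mul_inv_cancel two_ne_zero (by simp), one_pow, one_mul]
        _ ≤ _ := by gcongr
    calc c ^ (k + i) * V = c ^ k * V * c ^ i := by rw [pow_add]; ring
      _ ≤ c ^ k * V * (2 ^ (d * (k + 1)) * Metric.ediam s ^ d) := by gcongr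
      _ = _ := by ring

/-- Measures constructed from set functions above `diam ^ d` dominate, up to constants, the measure
of the projection. -/
theorem measure_proj_image_le_mkMetric' (hδ : IsHalving δ)
    (hM : IsClosed (M : Set G)) (hH : IsClosed (H : Set G))
    (hδM : ∀ g, δ g ∈ M ↔ g ∈ M) (hδH : ∀ g, δ g ∈ H ↔ g ∈ H)
    [ProperSpace M] (ν : Measure M) [ν.IsHaarMeasure] {d : ℕ} (hd : d ≠ 0)
    (hc : mulEquivHaarChar (δ.restrictSubgroup M hδM) ≤ (1 / 2) ^ d) (q : G) (k : ℕ)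
    {w : Set G → ℝ≥0∞} (hw : ∀ s, Metric.ediam s ^ d ≤ w s) (A : Set G) :
    ν ((fun g => hMH.proj (q * g)) '' A) ≤
      (mulEquivHaarChar (δ.restrictSubgroup M hδM) : ℝ≥0∞) ^ k *
        ν (hMH.proj '' Metric.closedBall 1 1) * 2 ^ (d * (k + 1)) * Measure.mkMetric' w A := by
  set a : ℝ≥0∞ := (mulEquivHaarChar (δ.restrictSubgroup M hδM) : ℝ≥0∞) ^ k *
        ν (hMH.proj '' Metric.closedBall 1 1) * 2 ^ (d * (k + 1))
  have hc0 : (mulEquivHaarChar (δ.restrictSubgroup M hδM) : ℝ≥0∞) ≠ 0 := by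
    simpa using (mulEquivHaarChar_pos (δ.restrictSubgroup M hδM)).ne'
  have hV0 : ν (hMH.proj '' Metric.closedBall 1 1) ≠ 0 := by
    refine ((Metric.measure_closedBall_pos ν 1 one_pos).trans_le (measure_mono ?_)).ne'
    exact fun m hm => ⟨m, hm, hMH.proj_coe m⟩
  have hVt : ν (hMH.proj '' Metric.closedBall 1 1) ≠ ∞ :=
    ((isCompact_closedBall 1 1).image (hMH.continuous_proj hM hH)).measure_lt_top.ne
  have ha0 : a ≠ 0 := mul_ne_zero (mul_ne_zero (pow_ne_zero _ hc0) hV0) (by simp)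
  have hat : a ≠ ∞ := ENNReal.mul_ne_top (ENNReal.mul_ne_top (by simp) hVt) (by simp)
  -- Projections of arbitrary sets need not be measurable, so the comparison is between outer
  -- measures, on sets of diameter at most 2^{-k}.
  set θ : OuterMeasure G :=
    a⁻¹ • OuterMeasure.comap (fun g => hMH.proj (q * g)) ν.toOuterMeasure
  have hθ : ∀ s, θ s = a⁻¹ * ν ((fun g => hMH.proj (q * g)) '' s) := fun s => rfl
  have h1 : θ ≤ OuterMeasure.mkMetric'.pre w ((1 / 2) ^ k) := by
    rw [OuterMeasure.mkMetric'.le_pre]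
    intro s hs
    refine le_trans ?_ (hw s)
    rw [hθ, ENNReal.inv_mul_le_iff ha0 hat]
    exact hMH.measure_proj_image_le hδ hM hH hδM hδH ν hd hc q k hs
  have h2 : θ ≤ OuterMeasure.mkMetric' w :=
    h1.trans (le_iSup₂_of_le ((1 / 2) ^ k) (ENNReal.pow_pos (by simp) k) le_rfl)
  have h3 : θ A ≤ Measure.mkMetric' w A :=
    (h2 A).trans (le_toMeasure_apply _ _ _)
  rwa [hθ, ENNReal.inv_mul_le_iff ha0 hat] at h3

/-- A set whose projection from one of its points `g₀` covers a neighbourhood, with control of the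
distance to `g₀`, has large `d`-dimensional measure near `g₀`. -/
theorem exists_le_mkMetric'_inter (hδ : IsHalving δ)
    (hM : IsClosed (M : Set G)) (hH : IsClosed (H : Set G))
    (hδM : ∀ g, δ g ∈ M ↔ g ∈ M) (hδH : ∀ g, δ g ∈ H ↔ g ∈ H)
    {d : ℕ} (hd : d ≠ 0) (hdim : dimH (M : Set G) = d)
    {w : Set G → ℝ≥0∞} (hw : ∀ s, Metric.ediam s ^ d ≤ w s)
    {S : Set G} {g₀ : G} {r L : ℝ} (hr : 0 < r)
    (hS : ∀ m : M, m ≠ 1 → dist m 1 ≤ r → ∃ g ∈ S, g ≠ g₀ ∧ hMH.proj (g₀⁻¹ * g) = m ∧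
      dist g g₀ ≤ L * dist m 1) :
    ∃ κ : ℝ≥0∞, κ ≠ 0 ∧ ∀ k : ℕ, κ * (1 / 2) ^ (d * k) ≤
      Measure.mkMetric' w (S ∩ (Metric.closedBall g₀ ((1 / 2) ^ k) \ {g₀})) := by
  have : ProperSpace M := ProperSpace.of_isClosed hM
  set ν : Measure M := haar
  have hdim' : dimH (univ : Set M) = d := by
    rw [← hdim, ← (isometry_subtype_coe (s := (M : Set G))).dimH_image]
    simp
  set δM := δ.restrictSubgroup M hδM
  have hδ' : IsHalving δM := hδ.restrictSubgroup M hδM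
  have hc := hδ'.mulEquivHaarChar_le hd hdim'
  have hnt : Nontrivial M := by
    by_contra hn
    rw [not_nontrivial_iff_subsingleton] at hn
    have := dimH_subsingleton (s := (univ : Set M)) subsingleton_of_subsingleton
    rw [hdim'] at this
    exact hd (by exact_mod_cast this)
  set c : ℝ≥0∞ := (mulEquivHaarChar δM : ℝ≥0∞)
  have hc0 : c ≠ 0 := by simpa [c] using (mulEquivHaarChar_pos δM).ne'
  set V := ν (hMH.proj '' Metric.closedBall 1 1)
  have hVt : V ≠ ∞ :=
    ((isCompact_closedBall 1 1).image (hMH.continuous_proj hM hH)).measure_lt_top.ne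
  set D : Set M := Metric.closedBall 1 1 \ {1}
  have hpow : ∀ k : ℕ, δM^[k] '' D = Metric.closedBall 1 ((1 / 2) ^ k) \ {1} := by
    intro k
    induction k with
    | zero => simp [D]
    | succ k ih =>
      rw [Function.iterate_succ', image_comp, ih, image_sdiff δM.injective, hδ'.image_closedBall]
      simp [pow_succ, div_eq_mul_inv]
  have hνD : ∀ k : ℕ, ν (Metric.closedBall 1 ((1 / 2) ^ k) \ {1}) = c ^ k * ν D := by
    intro k
    rw [← hpow k]
    induction k with
    | zero => simp
    | succ k ih =>
      rw [Function.iterate_succ', image_comp, IsHalving.measure_image, ih, pow_succ]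
      ring
  -- A nontrivial element of M, contracted into the unit ball, shows that the open punctured ball is
  -- nonempty.
  have hD0 : ν D ≠ 0 := by
    obtain ⟨m, hm⟩ := exists_ne (1 : M)
    have hm0 : 0 < dist m 1 := dist_pos.2 hm
    obtain ⟨j, hj⟩ := exists_pow_lt_of_lt_one (show (0 : ℝ) < 1 / dist m 1 by positivity)
      (show (1 / 2 : ℝ) < 1 by norm_num)
    have hdist : ∀ k : ℕ, dist (δM^[k] m) 1 = (1 / 2) ^ k * dist m 1 := by
      intro k
      induction k with
      | zero => simp
      | succ k ih => rw [Function.iterate_succ_apply', hδ'.dist_one, ih, pow_succ]; ring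
    have hopen : IsOpen (Metric.ball (1 : M) 1 \ {1}) :=
      Metric.isOpen_ball.sdiff isClosed_singleton
    have hne : (Metric.ball (1 : M) 1 \ {1}).Nonempty := by
      refine ⟨δM^[j] m, ?_, ?_⟩
      · rw [Metric.mem_ball, hdist]
        rwa [lt_div_iff₀ hm0] at hj
      · rw [mem_singleton_iff, ← dist_eq_zero, hdist]
        positivity
    exact ((hopen.measure_pos ν hne).trans_le
      (measure_mono (sdiff_subset_sdiff_left Metric.ball_subset_closedBall))).ne'
  -- J ensures 2^{-J} ≤ r, so that `hS` applies, and L 2^{-J} ≤ 1, so that the points found over the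
  -- ball of radius 2^{-k-J} lie within 2^{-k} of g₀.
  obtain ⟨J, hJ⟩ := exists_pow_lt_of_lt_one
    (show (0 : ℝ) < min r (1 / (|L| + 1)) by positivity) (show (1 / 2 : ℝ) < 1 by norm_num)
  have hJr : (1 / 2 : ℝ) ^ J ≤ r := hJ.le.trans (min_le_left _ _)
  have hJL : L * (1 / 2 : ℝ) ^ J ≤ 1 := by
    have h1 : (1 / 2 : ℝ) ^ J ≤ 1 / (|L| + 1) := hJ.le.trans (min_le_right _ _)
    rw [le_div_iff₀ (by positivity)] at h1
    have h2 : (0 : ℝ) < (1 / 2) ^ J := by positivity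
    nlinarith [le_abs_self L]
  refine ⟨c ^ J * ν D / (V * 2 ^ d), ?_, fun k => ?_⟩
  · exact (ENNReal.div_pos (mul_ne_zero (pow_ne_zero _ hc0) hD0)
      (ENNReal.mul_ne_top hVt (by simp))).ne'
  set A := S ∩ (Metric.closedBall g₀ ((1 / 2) ^ k) \ {g₀})
  have h1 := hMH.measure_proj_image_le_mkMetric' hδ hM hH hδM hδH ν hd hc g₀⁻¹ k hw A
  have h2 : Metric.closedBall 1 ((1 / 2) ^ (k + J)) \ {1} ⊆
      (fun g => hMH.proj (g₀⁻¹ * g)) '' A := by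
    rintro m ⟨hm, hm1⟩
    rw [Metric.mem_closedBall] at hm
    have hk1 : (1 / 2 : ℝ) ^ k ≤ 1 := pow_le_one₀ (by norm_num) (by norm_num)
    have hk0 : (0 : ℝ) < (1 / 2) ^ k := by positivity
    have hJ0 : (0 : ℝ) < (1 / 2) ^ J := by positivity
    rw [pow_add] at hm
    obtain ⟨g, hgS, hg0, hgm, hgd⟩ := hS m hm1 (by nlinarith)
    refine ⟨g, ⟨hgS, ?_, hg0⟩, hgm⟩
    rw [Metric.mem_closedBall]
    rcases le_or_gt L 0 with hL | hL
    · nlinarith [dist_nonneg (x := m) (y := 1)]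
    · calc dist g g₀ ≤ L * dist m 1 := hgd
        _ ≤ L * ((1 / 2) ^ k * (1 / 2) ^ J) := by gcongr
        _ = (L * (1 / 2) ^ J) * (1 / 2) ^ k := by ring
        _ ≤ 1 * (1 / 2) ^ k := by gcongr
        _ = _ := one_mul _
  have h3 := (measure_mono h2).trans h1
  rw [hνD] at h3
  set X := Measure.mkMetric' w A
  have hck0 : c ^ k ≠ 0 := pow_ne_zero _ hc0
  have hckt : c ^ k ≠ ∞ := by simp [c]
  have h4 : c ^ J * ν D ≤ V * 2 ^ (d * (k + 1)) * X := by
    rw [← ENNReal.mul_le_mul_iff_right hck0 hckt]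
    calc _ = c ^ (k + J) * ν D := by rw [pow_add]; ring
      _ ≤ _ := h3
      _ = _ := by simp only [V, c, δM]; ring
  have h5 : (2 : ℝ≥0∞) ^ (d * k) * (1 / 2) ^ (d * k) = 1 := by
    rw [← mul_pow, one_div, ENNReal.mul_inv_cancel two_ne_zero (by simp), one_pow]
  rw [mul_comm, ← mul_div_assoc]
  refine ENNReal.div_le_of_le_mul ?_
  calc (1 / 2) ^ (d * k) * (c ^ J * ν D)
      ≤ (1 / 2) ^ (d * k) * (V * 2 ^ (d * (k + 1)) * X) := by gcongr
    _ = (2 ^ (d * k) * (1 / 2) ^ (d * k)) * (X * (V * 2 ^ d)) := by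
      rw [mul_add, pow_add, mul_one]; ring
    _ = _ := by rw [h5, one_mul]

/-- Intrinsic graphs that meet a cone only at its vertex `g₀` project onto neighbourhoods. -/
theorem exists_mem_graph_of_cone (hM : IsClosed (M : Set G)) (hH : IsClosed (H : Set G))
    {Ω : Set M} (hΩ : IsOpen Ω) {f : M → H} {L : ℝ} (hL : 0 < L) {g₀ : G}
    (hg₀ : g₀ ∈ CarnotGroup.intrinsicGraph Ω f)
    (hcone : ∀ (m : M) (h : H), g₀ * (m * h) ∈ CarnotGroup.intrinsicGraph Ω f →
      dist m 1 ≤ 1 / L * dist h 1 → g₀ * (m * h) = g₀) :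
    ∃ r : ℝ, 0 < r ∧ ∀ m : M, m ≠ 1 → dist m 1 ≤ r → ∃ g ∈ CarnotGroup.intrinsicGraph Ω f,
      g ≠ g₀ ∧ hMH.proj (g₀⁻¹ * g) = m ∧ dist g g₀ ≤ (1 + L) * dist m 1 := by
  have hcont : Continuous fun m : M => hMH.proj (g₀ * m) := by
    have := hMH.continuous_proj hM hH
    fun_prop
  have hmem : (fun m : M => hMH.proj (g₀ * m)) ⁻¹' Ω ∈ 𝓝 (1 : M) := by
    refine (hΩ.preimage hcont).mem_nhds ?_
    obtain ⟨m₀, hm₀, rfl⟩ := hg₀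
    simpa [hMH.proj_mul] using hm₀
  obtain ⟨r, hr, hball⟩ := Metric.nhds_basis_closedBall.mem_iff.1 hmem
  refine ⟨r, hr, fun m hm1 hmr => ?_⟩
  -- The graph point g over P_M(g₀ m) satisfies P_M(g₀⁻¹ g) = P_M(g₀⁻¹ g₀ m) = m.
  have hm : hMH.proj (g₀ * m) ∈ Ω := hball hmr
  set m₁ := hMH.proj (g₀ * m)
  have hproj : hMH.proj (g₀⁻¹ * ((m₁ : G) * f m₁)) = m := by
    rw [← mul_assoc, hMH.proj_mul_right, hMH.proj_mul_proj, inv_mul_cancel_left, hMH.proj_coe]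
  set g : G := (m₁ : G) * f m₁
  have hgS : g ∈ CarnotGroup.intrinsicGraph Ω f := ⟨m₁, hm, rfl⟩
  have hg : g₀⁻¹ * g = m * hMH.projSnd (g₀⁻¹ * g) := by
    conv_lhs => rw [← hMH.proj_mul_projSnd (g₀⁻¹ * g), hproj]
  set h := hMH.projSnd (g₀⁻¹ * g)
  have hgeq : g₀ * (m * h) = g := by rw [← hg, mul_inv_cancel_left]
  have hne : g ≠ g₀ := by
    intro he
    rw [he, inv_mul_cancel] at hproj
    exact hm1 (by rw [← hproj]; exact hMH.proj_coe 1)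
  refine ⟨g, hgS, hne, hproj, ?_⟩
  -- As g ≠ g₀, the point g lies outside the cone at g₀; this bounds the H-component of g₀⁻¹ g by L
  -- times its M-component.
  have hlt : 1 / L * dist h 1 < dist m 1 := by
    by_contra! hle
    exact hne (hgeq ▸ hcone m h (by rw [hgeq]; exact hgS) hle)
  have hlt' : dist h 1 ≤ L * dist m 1 := by
    rw [one_div, inv_mul_lt_iff₀ hL] at hlt
    exact hlt.le
  rw [← dist_inv_mul_one, hg]
  have h1 := dist_mul_one_le (m : G) (h : G)
  have h2 : dist (m : G) 1 = dist m 1 := rfl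
  have h3 : dist (h : G) 1 = dist h 1 := rfl
  linarith

end Subgroup.IsComplement'

end Graph

/-! ### The grading: dilations as automorphisms, determinants, filtration. -/

theorem map_nestedBracket {L : Type*} [LieRing L] (φ : L → L)
    (h0 : φ 0 = 0) (hφ : ∀ x y, φ ⁅x, y⁆ = ⁅φ x, φ y⁆) (w : List L) :
    φ (nestedBracket w) = nestedBracket (w.map φ) := by
  induction w with
  | nil => simpa [nestedBracket]
  | cons x t ih =>
    cases t with
    | nil => simp [nestedBracket]
    | cons y t => simp only [nestedBracket, List.map_cons] at ih ⊢; rw [hφ, ih]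

theorem map_bch {L : Type*} [LieRing L] [LieAlgebra ℝ L] (φ : L →ₗ[ℝ] L)
    (hφ : ∀ x y, φ ⁅x, y⁆ = ⁅φ x, φ y⁆) (l : ℕ) (x y : L) :
    φ (bch l x y) = bch l (φ x) (φ y) := by
  simp only [bch, map_sum]
  refine Finset.sum_congr rfl fun n _ => Finset.sum_congr rfl fun w _ => ?_
  split_ifs
  · rw [map_smul, map_nestedBracket φ (map_zero φ) hφ, List.map_flatten, List.map_ofFn]
    simp [Function.comp_def]
  · exact map_zero φ

namespace CarnotGroup

section Graded

variable {𝔤 G : Type*} [LieRing 𝔤] [LieAlgebra ℝ 𝔤] [TopologicalSpace 𝔤]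
  [Group G] [TopologicalSpace G] (C : CarnotGroup 𝔤 G)

/-- Induction on i: layer i + 1 is spanned by brackets [a, b] with a in layer 1 and b in layer i,
and Jacobi gives [[a, b], y] = [a, [b, y]] - [b, [a, y]]. -/
theorem lie_mem_layer (i j : ℕ) {x y : 𝔤} (hx : x ∈ C.layer i) (hy : y ∈ C.layer j) :
    ⁅x, y⁆ ∈ C.layer (i + j) := by
  have zero_case : ∀ {k : ℕ} {z : 𝔤}, k = 0 → z ∈ C.layer k → z = 0 := by
    rintro _ z rfl hz
    rw [C.layer_zero] at hz
    exact (Submodule.mem_bot ℝ).1 hz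
  induction i generalizing j x y with
  | zero => rw [zero_case rfl hx, zero_lie]; exact zero_mem _
  | succ i ih =>
    have one_case : ∀ (j : ℕ) {x y : 𝔤}, x ∈ C.layer 1 → y ∈ C.layer j →
        ⁅x, y⁆ ∈ C.layer (j + 1) := by
      intro j x y hx hy
      rcases Nat.eq_zero_or_pos j with rfl | hj
      · rw [zero_case rfl hy, lie_zero]; exact zero_mem _
      · rw [← C.bracket_layer j hj]
        exact Submodule.subset_span ⟨x, hx, y, hy, rfl⟩
    rcases Nat.eq_zero_or_pos i with rfl | hi
    · rw [zero_add, add_comm]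
      exact one_case j hx hy
    · rw [← C.bracket_layer i hi] at hx
      induction hx using Submodule.span_induction with
      | mem x h =>
        obtain ⟨a, ha, b, hb, rfl⟩ := h
        rw [lie_lie]
        refine sub_mem ?_ ?_
        · have := one_case _ ha (ih j hb hy)
          rwa [show i + 1 + j = i + j + 1 by ring]
        · have := ih _ hb (one_case j ha hy)
          rwa [show i + 1 + j = i + (j + 1) by ring]
      | zero => rw [zero_lie]; exact zero_mem _
      | add a b _ _ h1 h2 => rw [add_lie]; exact add_mem h1 h2
      | smul t a _ h1 => rw [smul_lie]; exact Submodule.smul_mem _ _ h1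

@[elab_as_elim]
theorem layer_induction {P : 𝔤 → Prop} (x : 𝔤) (hmem : ∀ k, ∀ x ∈ C.layer k, P x)
    (hadd : ∀ x y, P x → P y → P (x + y)) : P x := by
  have hx : x ∈ ⨆ k, C.layer k := by rw [C.isInternal.submodule_iSup_eq_top]; trivial
  exact Submodule.iSup_induction (motive := P) _ hx hmem (hmem 0 0 (zero_mem _)) hadd

theorem lieDilation_of_mem (t : ℝ) {k : ℕ} {x : 𝔤} (hx : x ∈ C.layer k) :
    C.lieDilation t x = t ^ k • x := by
  have hcomp : ∀ j, C.component j x = if k = j then x else 0 := by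
    intro j
    have h1 : (LinearEquiv.ofBijective (DirectSum.coeLinearMap C.layer) C.isInternal).symm x =
        DirectSum.lof ℝ ℕ (fun i => C.layer i) k ⟨x, hx⟩ := by
      rw [LinearEquiv.symm_apply_eq]
      exact (DirectSum.coeLinearMap_lof C.layer k ⟨x, hx⟩).symm
    simp only [component, LinearMap.coe_comp, Function.comp_apply, LinearEquiv.coe_coe, h1]
    split_ifs with h
    · subst h
      simp [DirectSum.component.lof_self]
    · simp [DirectSum.component.of, h]
  simp only [lieDilation, LinearMap.sum_apply, LinearMap.smul_apply, hcomp, smul_ite, smul_zero]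
  rw [Finset.sum_ite_eq]
  split_ifs with h
  · rfl
  · have hb : C.layer k = ⊥ := by
      rcases Nat.eq_zero_or_pos k with rfl | hk
      · exact C.layer_zero
      · refine C.layer_eq_bot k ?_
        by_contra hle
        exact h (Finset.mem_Icc.2 ⟨hk, not_lt.1 hle⟩)
    rw [hb] at hx
    rw [(Submodule.mem_bot ℝ).1 hx, smul_zero]

theorem lieDilation_lie (t : ℝ) (x y : 𝔤) :
    C.lieDilation t ⁅x, y⁆ = ⁅C.lieDilation t x, C.lieDilation t y⁆ := by
  refine C.layer_induction x (fun i x hx => ?_) fun a b ha hb => by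
    rw [add_lie, map_add, ha, hb, map_add, add_lie]
  refine C.layer_induction y (fun j y hy => ?_) fun a b ha hb => by
    rw [lie_add, map_add, ha, hb, map_add, lie_add]
  rw [C.lieDilation_of_mem t hx, C.lieDilation_of_mem t hy,
    C.lieDilation_of_mem t (C.lie_mem_layer i j hx hy), smul_lie, lie_smul, smul_smul, pow_add]

theorem lieDilation_lieDilation (s t : ℝ) (x : 𝔤) :
    C.lieDilation s (C.lieDilation t x) = C.lieDilation (s * t) x := by
  refine C.layer_induction x (fun i x hx => ?_) fun a b ha hb => by
    simp only [map_add, ha, hb]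
  rw [C.lieDilation_of_mem t hx, map_smul, C.lieDilation_of_mem s hx,
    C.lieDilation_of_mem _ hx, smul_smul, mul_pow, mul_comm]

theorem dilation_mul (t : ℝ) (g h : G) : C.dilation t (g * h) = C.dilation t g * C.dilation t h := by
  obtain ⟨x, rfl⟩ := C.exp.surjective g
  obtain ⟨y, rfl⟩ := C.exp.surjective h
  simp only [dilation, C.exp_mul_exp, Homeomorph.symm_apply_apply]
  rw [map_bch _ (C.lieDilation_lie t)]

/-- In a basis adapted to the layers the dilation is diagonal, with t^k occurring dim 𝔤_k times. -/
theorem det_lieDilation [FiniteDimensional ℝ 𝔤] (t : ℝ) :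
    LinearMap.det (C.lieDilation t) = t ^ C.homDim := by
  classical
  set b := C.isInternal.collectedBasis fun i => Module.finBasis ℝ (C.layer i)
  have : Finite (Σ i, Fin (Module.finrank ℝ (C.layer i))) := Module.Finite.finite_basis b
  have := Fintype.ofFinite (Σ i, Fin (Module.finrank ℝ (C.layer i)))
  have hmat : LinearMap.toMatrix b b (C.lieDilation t) =
      Matrix.diagonal fun a : (Σ i, Fin (Module.finrank ℝ (C.layer i))) => t ^ a.1 := by
    ext p q
    have hmem : b q ∈ C.layer q.1 := C.isInternal.collectedBasis_mem _ q
    rw [LinearMap.toMatrix_apply, C.lieDilation_of_mem t hmem, map_smul, Module.Basis.repr_self]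
    simp only [Finsupp.smul_apply, Finsupp.single_apply, Matrix.diagonal_apply, smul_eq_mul]
    by_cases h : q = p
    · subst h; simp
    · simp [h, Ne.symm h]
  rw [← LinearMap.det_toMatrix b, hmat, Matrix.det_diagonal, Finset.prod_pow_eq_pow_sum, homDim]
  congr 1
  have h1 : (Finset.univ : Finset (Σ i, Fin (Module.finrank ℝ (C.layer i)))) =
      (Finset.Icc 1 C.step).sigma fun _ => Finset.univ := by
    ext ⟨i, a⟩
    simp only [Finset.mem_univ, Finset.mem_sigma, and_true, true_iff, Finset.mem_Icc]
    have hne : C.layer i ≠ ⊥ := by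
      intro hb
      have h0 : Module.finrank ℝ (C.layer i) = 0 := by rw [hb]; exact finrank_bot ℝ 𝔤
      exact (h0 ▸ a).elim0
    refine ⟨Nat.one_le_iff_ne_zero.2 ?_, ?_⟩
    · rintro rfl; exact hne C.layer_zero
    · by_contra hlt
      exact hne (C.layer_eq_bot i (not_le.1 hlt))
  rw [h1, Finset.sum_sigma]
  refine Finset.sum_congr rfl fun i _ => ?_
  simp [mul_comm]

/-- The descending filtration `⨁_{j ≥ k} 𝔤_j`. -/
def filtration (k : ℕ) : Submodule ℝ 𝔤 := ⨆ j, ⨆ (_ : k ≤ j), C.layer j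

theorem filtration_zero : C.filtration 0 = ⊤ := by
  simp [filtration, C.isInternal.submodule_iSup_eq_top]

theorem filtration_succ_step : C.filtration (C.step + 1) = ⊥ := by
  simp only [filtration, iSup_eq_bot]
  exact fun j hj => C.layer_eq_bot j hj

theorem layer_le_filtration {j k : ℕ} (h : k ≤ j) : C.layer j ≤ C.filtration k :=
  le_iSup₂_of_le j h le_rfl

theorem filtration_succ_le (k : ℕ) : C.filtration (k + 1) ≤ C.filtration k :=
  iSup₂_le fun _ hj => C.layer_le_filtration ((Nat.le_succ k).trans hj)

/-- Layer 0 vanishes, so every x has components of degree at least 1 only. -/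
theorem lie_mem_filtration (k : ℕ) (x : 𝔤) {v : 𝔤} (hv : v ∈ C.filtration k) :
    ⁅x, v⁆ ∈ C.filtration (k + 1) := by
  refine C.layer_induction x (fun i x hx => ?_) fun a b ha hb => by
    rw [add_lie]; exact add_mem ha hb
  have hle : C.filtration k ≤ (C.filtration (k + 1)).comap (LieAlgebra.ad ℝ 𝔤 x : 𝔤 →ₗ[ℝ] 𝔤) := by
    refine iSup₂_le fun j hj v hv => ?_
    rcases Nat.eq_zero_or_pos i with rfl | hi
    · rw [C.layer_zero] at hx
      rw [(Submodule.mem_bot ℝ).1 hx]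
      simp
    · exact C.layer_le_filtration (by omega) (C.lie_mem_layer i j hx hv)
  exact hle hv

/-- D - 1 raises the filtration degree, so it is nilpotent; det D is the characteristic polynomial
X^N of 1 - D evaluated at 1. -/
theorem det_eq_one_of_filtration [FiniteDimensional ℝ 𝔤] (D : 𝔤 →ₗ[ℝ] 𝔤)
    (hD : ∀ k, ∀ v ∈ C.filtration k, D v - v ∈ C.filtration (k + 1)) : LinearMap.det D = 1 := by
  set N : 𝔤 →ₗ[ℝ] 𝔤 := D - 1
  have hN : ∀ k v, (N ^ k) v ∈ C.filtration k := by
    intro k v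
    induction k with
    | zero => rw [C.filtration_zero]; trivial
    | succ k ih => rw [pow_succ']; exact hD k _ ih
  have hnil : IsNilpotent (-N) := by
    refine IsNilpotent.neg ⟨C.step + 1, ?_⟩
    ext v
    have := hN (C.step + 1) v
    rw [C.filtration_succ_step] at this
    simpa using this
  have h1 := hnil.charpoly_eq_X_pow_finrank
  have h2 := LinearMap.eval_charpoly (-N) 1
  rw [h1] at h2
  have h3 : algebraMap ℝ (Module.End ℝ 𝔤) 1 - -N = D := by
    rw [map_one, sub_neg_eq_add]
    exact add_sub_cancel 1 D
  rw [h3] at h2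
  simpa using h2.symm

end Graded

end CarnotGroup

/-! ### The Baker-Campbell-Hausdorff product as a sum over words. -/

/-- The value of the word `W` in two letters at `x` and `y`. -/
def wordBracket {L : Type*} [LieRing L] (W : List Bool) (x y : L) : L :=
  nestedBracket (W.map fun b => if b then x else y)

/-- The word `x^{r₁} y^{s₁} ⋯ x^{rₙ} y^{sₙ}`. -/
def exponentWord {n l : ℕ} (w : Fin n → Fin (l + 1) × Fin (l + 1)) : List Bool :=
  List.flatten (List.ofFn fun i =>
    List.replicate ((w i).1 : ℕ) true ++ List.replicate ((w i).2 : ℕ) false)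

/-- The coefficient of the word with exponents `w` in the Baker-Campbell-Hausdorff series. -/
def bchCoeff {n l : ℕ} (w : Fin n → Fin (l + 1) × Fin (l + 1)) : ℝ :=
  if (∀ i, 0 < ((w i).1 : ℕ) + ((w i).2 : ℕ)) ∧
      ∑ i, (((w i).1 : ℕ) + ((w i).2 : ℕ)) ≤ l then
    (-1 : ℝ) ^ (n - 1) / (n : ℝ) /
      (((∑ i, (((w i).1 : ℕ) + ((w i).2 : ℕ)) : ℕ) : ℝ) *
        ((∏ i, (Nat.factorial (w i).1 * Nat.factorial (w i).2) : ℕ) : ℝ))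
  else 0

theorem bch_eq_sum_wordBracket {L : Type*} [LieRing L] [LieAlgebra ℝ L] (l : ℕ) (x y : L) :
    bch l x y = ∑ n ∈ Finset.Icc 1 l, ∑ w : Fin n → Fin (l + 1) × Fin (l + 1),
      bchCoeff w • wordBracket (exponentWord w) x y := by
  refine Finset.sum_congr rfl fun n _ => Finset.sum_congr rfl fun w _ => ?_
  rw [bchCoeff]
  split_ifs
  · rw [wordBracket, exponentWord, List.map_flatten, List.map_ofFn]
    simp [Function.comp_def]
  · rw [zero_smul]

theorem wordBracket_cons_cons {L : Type*} [LieRing L] (a b : Bool) (W : List Bool) (x y : L) :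
    wordBracket (a :: b :: W) x y = ⁅if a then x else y, wordBracket (b :: W) x y⁆ := rfl

namespace CarnotGroup

section Filtration

variable {𝔤 G : Type*} [LieRing 𝔤] [LieAlgebra ℝ 𝔤] [TopologicalSpace 𝔤]
  [Group G] [TopologicalSpace G] (C : CarnotGroup 𝔤 G)

theorem lie_mem_filtration_right (k : ℕ) (x : 𝔤) {v : 𝔤} (hv : v ∈ C.filtration k) :
    ⁅v, x⁆ ∈ C.filtration (k + 1) := by
  rw [← lie_skew]
  exact neg_mem (C.lie_mem_filtration k x hv)

/-- Modulo `⨁_{j > k} 𝔤_j`, only the word `y` sees a change of `y` in `⨁_{j ≥ k} 𝔤_j`. -/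
theorem wordBracket_add_sub_mem (k : ℕ) (W : List Bool) (x y : 𝔤) {v : 𝔤}
    (hv : v ∈ C.filtration k) :
    wordBracket W x (y + v) - wordBracket W x y - (if W = [false] then (1 : ℝ) else 0) • v ∈
      C.filtration (k + 1) := by
  induction W with
  | nil => simp [wordBracket, nestedBracket]
  | cons a W ih =>
    cases W with
    | nil => cases a <;> simp [wordBracket, nestedBracket]
    | cons b W =>
      simp only [wordBracket_cons_cons, List.cons.injEq, reduceCtorEq, and_false, if_false,
        zero_smul, sub_zero]
      set p := wordBracket (b :: W) x (y + v)
      set q := wordBracket (b :: W) x y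
      have hpq : p - q ∈ C.filtration k := by
        have h1 := C.filtration_succ_le k ih
        have h2 := add_mem h1 (Submodule.smul_mem _ (if b :: W = [false] then (1 : ℝ) else 0) hv)
        rwa [sub_add_cancel] at h2
      cases a
      · have : ⁅y + v, p⁆ - ⁅y, q⁆ = ⁅y, p - q⁆ + ⁅v, p⁆ := by
          rw [add_lie, lie_sub]; abel
        simp only [Bool.false_eq_true, if_false]
        rw [this]
        exact add_mem (C.lie_mem_filtration k y hpq) (C.lie_mem_filtration_right k p hv)
      · simp only [if_true]
        rw [← lie_sub]
        exact C.lie_mem_filtration k x hpq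

/-- Modulo the next filtration step, changing y by v changes the product by a v, where a is the
total coefficient of the word y. The coefficient is not computed: the case x = y = 0, where the
product is v itself, shows that v - a v is negligible. -/
theorem bch_add_sub_mem (h0 : C.exp 0 = 1) (k : ℕ) (x y : 𝔤) {v : 𝔤}
    (hv : v ∈ C.filtration k) :
    bch C.step x (y + v) - bch C.step x y - v ∈ C.filtration (k + 1) := by
  set a : ℝ := ∑ n ∈ Finset.Icc 1 C.step,
    ∑ w : Fin n → Fin (C.step + 1) × Fin (C.step + 1),
      bchCoeff w * (if exponentWord w = [false] then (1 : ℝ) else 0)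
  have key : ∀ x y : 𝔤, bch C.step x (y + v) - bch C.step x y - a • v ∈
      C.filtration (k + 1) := by
    intro x y
    have : bch C.step x (y + v) - bch C.step x y - a • v =
        ∑ n ∈ Finset.Icc 1 C.step, ∑ w : Fin n → Fin (C.step + 1) × Fin (C.step + 1),
          bchCoeff w • (wordBracket (exponentWord w) x (y + v) - wordBracket (exponentWord w) x y -
            (if exponentWord w = [false] then (1 : ℝ) else 0) • v) := by
      simp only [bch_eq_sum_wordBracket, a, Finset.sum_smul, smul_sub, Finset.sum_sub_distrib,
        mul_smul]
    rw [this]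
    exact sum_mem fun n _ => sum_mem fun w _ =>
      Submodule.smul_mem _ _ (C.wordBracket_add_sub_mem k _ x y hv)
  have hbch : ∀ z : 𝔤, bch C.step 0 z = z := by
    intro z
    apply C.exp.injective
    rw [← C.exp_mul_exp, h0, one_mul]
  have h1 := key 0 0
  rw [hbch, hbch, zero_add, sub_zero] at h1
  have h2 := sub_mem (key x y) h1
  have h3 : bch C.step x (y + v) - bch C.step x y - a • v - (v - a • v) =
    bch C.step x (y + v) - bch C.step x y - v := by abel
  rwa [h3] at h2

end Filtration

/-! ### Haar measure in exponential coordinates. -/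

section Lebesgue

variable {𝔤 G : Type*} [LieRing 𝔤] [LieAlgebra ℝ 𝔤] [FiniteDimensional ℝ 𝔤]
  [TopologicalSpace 𝔤] [IsTopologicalAddGroup 𝔤] [ContinuousSMul ℝ 𝔤] [T2Space 𝔤]

/-- The bracket becomes a continuous bilinear map on a Euclidean space, which supplies the norm that
𝔤 does not carry. -/
theorem differentiable_wordBracket (W : List Bool) (x : 𝔤) :
    Differentiable ℝ fun u => toEuclidean (wordBracket W x ((toEuclidean (E := 𝔤)).symm u)) := by
  set T := toEuclidean (E := 𝔤)
  let B₀ : EuclideanSpace ℝ (Fin (Module.finrank ℝ 𝔤)) →ₗ[ℝ]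
      EuclideanSpace ℝ (Fin (Module.finrank ℝ 𝔤)) →ₗ[ℝ]
      EuclideanSpace ℝ (Fin (Module.finrank ℝ 𝔤)) :=
    LinearMap.mk₂ ℝ (fun a b => T ⁅T.symm a, T.symm b⁆) (by simp) (by simp) (by simp) (by simp)
  let B := B₀.toContinuousBilinearMap
  have hB : ∀ a b : 𝔤, T ⁅a, b⁆ = B (T a) (T b) := fun a b => by
    change _ = T ⁅T.symm (T a), T.symm (T b)⁆
    simp
  have hletter : ∀ b : Bool, Differentiable ℝ fun u => T (if b then x else T.symm u) := by
    intro b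
    cases b
    · simp
    · simp
  induction W with
  | nil => simp [wordBracket, nestedBracket]
  | cons a W ih =>
    cases W with
    | nil => exact hletter a
    | cons b W =>
      simp only [wordBracket_cons_cons, hB]
      exact (B.differentiable.comp (hletter a)).clm_apply ih

theorem differentiable_bch (l : ℕ) (x : 𝔤) :
    Differentiable ℝ fun u => toEuclidean (bch l x ((toEuclidean (E := 𝔤)).symm u)) := by
  simp only [bch_eq_sum_wordBracket, map_sum, map_smul]
  exact Differentiable.fun_sum fun n _ => Differentiable.fun_sum fun w _ =>
    (differentiable_wordBracket _ x).fun_const_smul _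

variable [Group G] [TopologicalSpace G] [IsTopologicalGroup G] (C : CarnotGroup 𝔤 G)

/-- By `bch_add_sub_mem` the difference quotients in a direction v of filtration degree k differ
from v by elements of degree k + 1. These form a closed subspace, so the derivative is unipotent. -/
theorem det_fderiv_bch (h0 : C.exp 0 = 1) (x : 𝔤)
    (u : EuclideanSpace ℝ (Fin (Module.finrank ℝ 𝔤))) :
    (fderiv ℝ (fun u => toEuclidean (bch C.step x ((toEuclidean (E := 𝔤)).symm u))) u).det = 1 := by
  set T := toEuclidean (E := 𝔤)
  set φ := fun u => T (bch C.step x (T.symm u))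
  set D := fderiv ℝ φ u
  have hD : HasFDerivAt φ D u := (differentiable_bch C.step x u).hasFDerivAt
  set D' : 𝔤 →ₗ[ℝ] 𝔤 :=
    T.symm.toLinearEquiv.toLinearMap ∘ₗ D.toLinearMap ∘ₗ T.toLinearEquiv.toLinearMap
  have h1 : LinearMap.det D' = 1 := by
    refine C.det_eq_one_of_filtration D' fun k v hv => ?_
    have hclosed : IsClosed (C.filtration (k + 1) : Set 𝔤) :=
      (C.filtration (k + 1)).closed_of_finiteDimensional
    have hlim := (hD.hasLineDerivAt (T v)).tendsto_slope_zero
    have hlim' := ((T.symm.continuous.tendsto _).comp hlim).sub_const v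
    refine hclosed.mem_of_tendsto hlim' ?_
    filter_upwards [self_mem_nhdsWithin] with t ht
    have ht0 : t ≠ 0 := ht
    have h2 := C.bch_add_sub_mem h0 k x (T.symm u) (Submodule.smul_mem _ t hv)
    have h3 := Submodule.smul_mem _ t⁻¹ h2
    have h4 : t⁻¹ • (bch C.step x (T.symm u + t • v) - bch C.step x (T.symm u) - t • v) =
        T.symm (t⁻¹ • (φ (u + t • T v) - φ (u + (0 : ℝ) • T v))) - v := by
      simp [φ, smul_sub, smul_smul, ht0]
    rw [h4] at h3
    simpa using h3
  have h2 : LinearMap.det D' = LinearMap.det D.toLinearMap :=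
    LinearMap.det_conj D.toLinearMap T.symm.toLinearEquiv
  rw [ContinuousLinearMap.det, ← h2, h1]

/-- Exponential coordinates in a Euclidean space. -/
def expEuclidean : EuclideanSpace ℝ (Fin (Module.finrank ℝ 𝔤)) ≃ₜ G :=
  (toEuclidean (E := 𝔤)).symm.toHomeomorph.trans C.exp

theorem continuous_dilation (t : ℝ) : Continuous (C.dilation t) :=
  C.exp.continuous.comp
    ((C.lieDilation t).continuous_of_finiteDimensional.comp C.exp.symm.continuous)

theorem dilation_dilation (s t : ℝ) (g : G) :
    C.dilation s (C.dilation t g) = C.dilation (s * t) g := by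
  simp [dilation, C.lieDilation_lieDilation]

theorem dilation_one (g : G) : C.dilation 1 g = g := by
  simp [dilation, C.lieDilation_one]

/-- The dilation by `1 / 2` as an automorphism. -/
def half : G ≃ₜ* G where
  toFun := C.dilation (1 / 2)
  invFun := C.dilation 2
  left_inv g := by rw [C.dilation_dilation]; norm_num [C.dilation_one]
  right_inv g := by rw [C.dilation_dilation]; norm_num [C.dilation_one]
  map_mul' := C.dilation_mul _
  continuous_toFun := C.continuous_dilation _
  continuous_invFun := C.continuous_dilation _

theorem half_apply (g : G) : C.half g = C.dilation (1 / 2) g := rfl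

variable [MeasurableSpace G] [BorelSpace G]

/-- Lebesgue measure in exponential coordinates is left invariant. -/
theorem isMulLeftInvariant_map_expEuclidean (h0 : C.exp 0 = 1) :
    (Measure.map C.expEuclidean volume).IsMulLeftInvariant := by
  have hm := C.expEuclidean.continuous.measurable
  refine ⟨fun g => ?_⟩
  obtain ⟨x, rfl⟩ := C.exp.surjective g
  have hmul : Measurable fun g : G => C.exp x * g := (continuous_const_mul _).measurable
  ext A hA
  rw [Measure.map_apply hmul hA, Measure.map_apply hm (hmul hA), Measure.map_apply hm hA]
  set T := toEuclidean (E := 𝔤)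
  set φ := fun u => T (bch C.step x (T.symm u))
  have hφ : ∀ u, C.expEuclidean (φ u) = C.exp x * C.expEuclidean u := by
    intro u
    simp [expEuclidean, φ, T, C.exp_mul_exp]
  have hinj : Function.Injective φ := by
    intro u v huv
    have h1 := congrArg C.expEuclidean huv
    rw [hφ, hφ] at h1
    exact C.expEuclidean.injective (mul_left_cancel h1)
  have hsurj : Function.Surjective φ := by
    intro u
    refine ⟨C.expEuclidean.symm ((C.exp x)⁻¹ * C.expEuclidean u), C.expEuclidean.injective ?_⟩
    rw [hφ]
    simp
  have hpre : C.expEuclidean ⁻¹' ((fun g => C.exp x * g) ⁻¹' A) =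
      φ ⁻¹' (C.expEuclidean ⁻¹' A) := by
    ext u
    simp only [mem_preimage, hφ]
  have hmeas : MeasurableSet (φ ⁻¹' (C.expEuclidean ⁻¹' A)) := by
    rw [← hpre]
    exact hm (hmul hA)
  rw [hpre]
  have key := lintegral_abs_det_fderiv_eq_addHaar_image volume hmeas
    (fun u _ => (differentiable_bch C.step x u).hasFDerivAt.hasFDerivWithinAt) hinj.injOn
  rw [image_preimage_eq _ hsurj] at key
  rw [← key]
  simp only [C.det_fderiv_bch h0, abs_one, ENNReal.ofReal_one, setLIntegral_one]

/-- Haar measure is Lebesgue measure up to a factor, and in these coordinates halving is linear with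
determinant 2^{-Q}. -/
theorem mulEquivHaarChar_half [LocallyCompactSpace G] [SecondCountableTopology G]
    (h0 : C.exp 0 = 1) : mulEquivHaarChar C.half = (1 / 2) ^ C.homDim := by
  set μ : Measure G := Measure.haar
  set lam := Measure.map C.expEuclidean volume
  have : lam.IsMulLeftInvariant := C.isMulLeftInvariant_map_expEuclidean h0
  have hlam : ∀ A, lam A = volume (C.expEuclidean ⁻¹' A) := fun A =>
    C.expEuclidean.toMeasurableEquiv.map_apply A
  have : IsFiniteMeasureOnCompacts lam := by
    refine ⟨fun A hA => ?_⟩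
    rw [hlam, ← C.expEuclidean.image_symm]
    exact (hA.image C.expEuclidean.symm.continuous).measure_lt_top
  set κ := Measure.haarScalarFactor lam μ
  have hκ : lam = κ • μ := Measure.isMulLeftInvariant_eq_smul _ _
  set B : Set G := C.expEuclidean '' Metric.closedBall 0 1
  have hB : C.expEuclidean ⁻¹' B = Metric.closedBall 0 1 :=
    C.expEuclidean.injective.preimage_image _
  have hB0 : lam B ≠ 0 := by
    rw [hlam, hB]; exact (Metric.measure_closedBall_pos volume _ one_pos).ne'
  have hBt : lam B ≠ ∞ := by
    rw [hlam, hB]; exact measure_closedBall_lt_top.ne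
  set T := toEuclidean (E := 𝔤)
  set D : EuclideanSpace ℝ (Fin (Module.finrank ℝ 𝔤)) →ₗ[ℝ]
      EuclideanSpace ℝ (Fin (Module.finrank ℝ 𝔤)) :=
    T.toLinearEquiv.toLinearMap ∘ₗ C.lieDilation (1 / 2) ∘ₗ T.symm.toLinearEquiv.toLinearMap
  have hDdet : LinearMap.det D = (1 / 2) ^ C.homDim := by
    rw [← C.det_lieDilation]
    exact LinearMap.det_conj (C.lieDilation (1 / 2)) T.toLinearEquiv
  have hcomm : ∀ u, C.half (C.expEuclidean u) = C.expEuclidean (D u) := by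
    intro u
    simp [half_apply, dilation, expEuclidean, D, T]
  have himg : C.half '' B = C.expEuclidean '' (D '' Metric.closedBall 0 1) := by
    rw [image_image, image_image]
    exact image_congr fun u _ => hcomm u
  have h1 : lam (C.half '' B) = ENNReal.ofReal ((1 / 2) ^ C.homDim) * lam B := by
    rw [hlam, himg, C.expEuclidean.injective.preimage_image, Measure.addHaar_image_linearMap, hDdet,
      hlam, hB, abs_of_pos (by positivity)]
  have h2 : lam (C.half '' B) = mulEquivHaarChar C.half * lam B := by
    have h3 : μ (C.half '' B) = mulEquivHaarChar C.half * μ B := by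
      rw [← mulEquivHaarChar_smul_preimage μ (X := C.half '' B) C.half,
        C.half.injective.preimage_image]
      rfl
    rw [hκ, Measure.smul_apply, Measure.smul_apply, h3, ENNReal.smul_def, ENNReal.smul_def,
      smul_eq_mul, smul_eq_mul, mul_left_comm]
  have h4 := (ENNReal.mul_left_inj hB0 hBt).1 (h2.symm.trans h1)
  rw [← ENNReal.coe_inj, h4, ENNReal.ofReal]
  congr 1
  rw [Real.toNNReal_pow (by norm_num)]
  congr 1
  ext
  simp

end Lebesgue

end CarnotGroup

/-! ### The radial function with a pole: finite energy, infinite integrals. -/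

section Pole

/-- The values `2^{dk} / (k + 1)` of a radial function with a pole of order `d`, up to a
logarithm, on the annuli of radii `2^{-k}`. -/
def poleValue (d k : ℕ) : ℝ := 2 ^ (d * k) / (k + 1)

theorem poleValue_pos (d k : ℕ) : 0 < poleValue d k := by
  rw [poleValue]; positivity

/-- The constant 4 closes the induction because 4 a_j ≤ 3 a_{j+1} for j ≥ 1, sharp at d = j = 1. The
step from j = 0 is checked separately. -/
theorem sum_poleValue_le {d : ℕ} (hd : d ≠ 0) (j : ℕ) :
    ∑ k ∈ Finset.range (j + 1), poleValue d k ≤ 4 * poleValue d j := by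
  induction j with
  | zero => simp [poleValue]
  | succ j ih =>
    rw [Finset.sum_range_succ]
    have h2 : (2 : ℝ) ≤ 2 ^ d := by
      calc (2 : ℝ) = 2 ^ 1 := (pow_one _).symm
        _ ≤ 2 ^ d := pow_le_pow_right₀ (by norm_num) (Nat.one_le_iff_ne_zero.2 hd)
    rcases Nat.eq_zero_or_pos j with rfl | hj
    · simp only [poleValue, zero_add, mul_one, Finset.sum_range_one, mul_zero, pow_zero]
      norm_num
      linarith
    · have h3 : 4 * poleValue d j ≤ 3 * poleValue d (j + 1) := by
        have hj1 : (1 : ℝ) ≤ j := by exact_mod_cast hj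
        have ht : (0 : ℝ) < 2 ^ (d * j) := by positivity
        simp only [poleValue, Nat.mul_add, mul_one, pow_add, Nat.cast_add, Nat.cast_one]
        rw [← mul_div_assoc, ← mul_div_assoc, div_le_div_iff₀ (by positivity) (by positivity)]
        nlinarith [mul_le_mul_of_nonneg_left h2 ht.le, mul_nonneg ht.le (sub_nonneg.2 hj1),
          mul_nonneg (mul_nonneg ht.le (sub_nonneg.2 h2)) (sub_nonneg.2 hj1)]
      linarith

/-- The index `k` of the dyadic interval `(2^{-k-1}, 2^{-k}]` that contains `r ∈ (0, 1]`. -/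
def dyadicIndex (r : ℝ) : ℕ := ⌊Real.logb (1 / 2) r⌋₊

theorem le_dyadicIndex_iff {r : ℝ} (h0 : 0 < r) (h1 : r ≤ 1) (k : ℕ) :
    k ≤ dyadicIndex r ↔ r ≤ (1 / 2) ^ k := by
  have hb : (0 : ℝ) < 1 / 2 := by norm_num
  have hb1 : (1 / 2 : ℝ) < 1 := by norm_num
  rw [dyadicIndex, Nat.le_floor_iff (Real.logb_nonneg_of_base_lt_one hb hb1 h0 h1),
    Real.le_logb_iff_rpow_le_of_base_lt_one hb hb1 h0, Real.rpow_natCast]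

variable {X : Type*} [PseudoMetricSpace X]

/-- A radial function with a pole at `x₀`. -/
def poleFun (d : ℕ) (x₀ x : X) : ℝ :=
  if 0 < dist x x₀ ∧ dist x x₀ ≤ 1 then poleValue d (dyadicIndex (dist x x₀)) else 0

theorem poleFun_nonneg (d : ℕ) (x₀ x : X) : 0 ≤ poleFun d x₀ x := by
  rw [poleFun]
  split_ifs
  exacts [(poleValue_pos _ _).le, le_rfl]

/-- A point of annulus j lies in the punctured balls of index 0 to j only. This turns lower bounds
for measures of balls into lower bounds for the integral. -/
theorem tsum_indicator_le_poleFun {d : ℕ} (hd : d ≠ 0) (x₀ x : X) :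
    ∑' k : ℕ, ({y | 0 < dist y x₀ ∧ dist y x₀ ≤ (1 / 2) ^ k} : Set X).indicator
      (fun _ => ENNReal.ofReal (poleValue d k)) x ≤ 4 * ENNReal.ofReal (poleFun d x₀ x) := by
  by_cases hx : 0 < dist x x₀ ∧ dist x x₀ ≤ 1
  · rw [poleFun, if_pos hx]
    set j := dyadicIndex (dist x x₀)
    rw [tsum_eq_sum (s := Finset.range (j + 1))]
    · calc _ ≤ ∑ k ∈ Finset.range (j + 1), ENNReal.ofReal (poleValue d k) :=
            Finset.sum_le_sum fun k _ => indicator_le_self _ _ x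
        _ = ENNReal.ofReal (∑ k ∈ Finset.range (j + 1), poleValue d k) :=
            (ENNReal.ofReal_sum_of_nonneg fun k _ => (poleValue_pos d k).le).symm
        _ ≤ ENNReal.ofReal (4 * poleValue d j) := ENNReal.ofReal_le_ofReal (sum_poleValue_le hd j)
        _ = _ := by rw [ENNReal.ofReal_mul (by norm_num), ENNReal.ofReal_ofNat]
    · intro k hk
      refine indicator_of_notMem (fun hmem => hk ?_) _
      rw [Finset.mem_range, Nat.lt_succ_iff]
      exact (le_dyadicIndex_iff hx.1 hx.2 k).2 hmem.2
  · have h0 : ∀ k : ℕ, ({y | 0 < dist y x₀ ∧ dist y x₀ ≤ (1 / 2) ^ k} : Set X).indicator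
        (fun _ => ENNReal.ofReal (poleValue d k)) x = 0 := by
      intro k
      refine indicator_of_notMem (fun hmem => hx ⟨hmem.1, hmem.2.trans ?_⟩) _
      exact pow_le_one₀ (by norm_num) (by norm_num)
    simp only [h0, tsum_zero, zero_le]

theorem poleFun_rpow_le_tsum (d : ℕ) {p : ℝ} (hp : 0 < p) (x₀ x : X) :
    ENNReal.ofReal (poleFun d x₀ x) ^ p ≤ ∑' k : ℕ, (Metric.closedBall x₀ ((1 / 2) ^ k)).indicator
      (fun _ => ENNReal.ofReal (poleValue d k) ^ p) x := by
  by_cases hx : 0 < dist x x₀ ∧ dist x x₀ ≤ 1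
  · rw [poleFun, if_pos hx]
    set j := dyadicIndex (dist x x₀)
    refine le_trans ?_ (ENNReal.le_tsum j)
    rw [indicator_of_mem]
    exact (le_dyadicIndex_iff hx.1 hx.2 j).1 le_rfl
  · rw [poleFun, if_neg hx, ENNReal.ofReal_zero, ENNReal.zero_rpow_of_pos hp]
    exact zero_le

variable [MeasurableSpace X] [BorelSpace X]

theorem measurable_poleFun (d : ℕ) (x₀ : X) : Measurable (poleFun d x₀) := by
  have hdist : Measurable fun x : X => dist x x₀ := (continuous_id.dist continuous_const).measurable
  have hidx : Measurable fun x : X => dyadicIndex (dist x x₀) :=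
    Nat.measurable_floor.comp ((Real.measurable_log.comp hdist).div_const _)
  refine Measurable.ite ?_ ((measurable_from_nat (f := poleValue d)).comp hidx) measurable_const
  exact (measurableSet_lt measurable_const hdist).inter (measurableSet_le hdist measurable_const)

theorem lintegral_poleFun_eq_top {d : ℕ} (hd : d ≠ 0) {x₀ : X} {σ : Measure X} {κ : ℝ≥0∞}
    (hκ : κ ≠ 0)
    (h : ∀ k : ℕ, κ * (1 / 2) ^ (d * k) ≤ σ {y | 0 < dist y x₀ ∧ dist y x₀ ≤ (1 / 2) ^ k}) :
    ∫⁻ x, ENNReal.ofReal (poleFun d x₀ x) ∂σ = ∞ := by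
  have hdist : Measurable fun x : X => dist x x₀ := (continuous_id.dist continuous_const).measurable
  have hmeas : ∀ k : ℕ, MeasurableSet {y : X | 0 < dist y x₀ ∧ dist y x₀ ≤ (1 / 2) ^ k} :=
    fun k => (measurableSet_lt measurable_const hdist).inter
      (measurableSet_le hdist measurable_const)
  have h1 : ∑' k : ℕ, ENNReal.ofReal (poleValue d k) *
      σ {y | 0 < dist y x₀ ∧ dist y x₀ ≤ (1 / 2) ^ k} ≤
      4 * ∫⁻ x, ENNReal.ofReal (poleFun d x₀ x) ∂σ := by
    rw [← lintegral_const_mul _ (measurable_poleFun d x₀).ennreal_ofReal]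
    calc _ = ∑' k : ℕ, ∫⁻ x, ({y | 0 < dist y x₀ ∧ dist y x₀ ≤ (1 / 2) ^ k} : Set X).indicator
            (fun _ => ENNReal.ofReal (poleValue d k)) x ∂σ :=
          tsum_congr fun k => (lintegral_indicator_const (hmeas k) _).symm
      _ = ∫⁻ x, ∑' k : ℕ, ({y | 0 < dist y x₀ ∧ dist y x₀ ≤ (1 / 2) ^ k} : Set X).indicator
            (fun _ => ENNReal.ofReal (poleValue d k)) x ∂σ :=
          (lintegral_tsum fun k => (measurable_const.indicator (hmeas k)).aemeasurable).symm
      _ ≤ _ := lintegral_mono fun x => tsum_indicator_le_poleFun hd x₀ x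
  -- The factors 2^{dk} and 2^{-dk} cancel and leave the harmonic series.
  have h2 : ∀ k : ℕ, κ * ENNReal.ofReal (1 / ((k : ℝ) + 1)) ≤ ENNReal.ofReal (poleValue d k) *
      σ {y | 0 < dist y x₀ ∧ dist y x₀ ≤ (1 / 2) ^ k} := by
    intro k
    refine le_trans (le_of_eq ?_) (mul_le_mul_right (h k) _)
    have h3 : ((1 / 2 : ℝ≥0∞)) ^ (d * k) = ENNReal.ofReal ((1 / 2) ^ (d * k)) := by
      rw [ENNReal.ofReal_pow (by norm_num), ENNReal.ofReal_div_of_pos two_pos]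
      simp
    rw [mul_left_comm, h3, ← ENNReal.ofReal_mul (poleValue_pos d k).le]
    congr 2
    rw [poleValue, div_mul_eq_mul_div, ← mul_pow]
    norm_num
  have h4 : ∑' k : ℕ, ENNReal.ofReal (1 / ((k : ℝ) + 1)) = ∞ := by
    by_contra hne
    have h5 := ENNReal.summable_toReal hne
    refine Real.not_summable_one_div_natCast ((summable_nat_add_iff 1).1 (h5.congr fun k => ?_))
    rw [ENNReal.toReal_ofReal (by positivity)]
    push_cast
    rfl
  have h6 : (∞ : ℝ≥0∞) ≤ 4 * ∫⁻ x, ENNReal.ofReal (poleFun d x₀ x) ∂σ := by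
    refine le_trans ?_ ((ENNReal.tsum_le_tsum h2).trans h1)
    rw [ENNReal.tsum_mul_left, h4, ENNReal.mul_top hκ]
  by_contra hne
  exact absurd h6 (not_le.2 (ENNReal.mul_lt_top (by simp) (lt_top_iff_ne_top.2 hne)))

theorem summable_poleValue_rpow {d Q : ℕ} (hdQ : d < Q) {p : ℝ} (hp : 0 < p)
    (hpQ : (d : ℝ) * p ≤ Q) :
    Summable fun k : ℕ => poleValue d k ^ p * (1 / 2) ^ (Q * k) := by
  have hterm : ∀ k : ℕ, poleValue d k ^ p * (1 / 2) ^ (Q * k) =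
      ((2 : ℝ) ^ ((d : ℝ) * p - Q)) ^ k * (1 / ((k : ℝ) + 1) ^ p) := by
    intro k
    rw [poleValue, Real.div_rpow (by positivity) (by positivity)]
    have h1 : ((2 : ℝ) ^ (d * k)) ^ p = (2 : ℝ) ^ ((d : ℝ) * p * k) := by
      rw [← Real.rpow_natCast, ← Real.rpow_mul (by norm_num)]
      push_cast
      ring_nf
    have h2 : ((1 / 2 : ℝ)) ^ (Q * k) = (2 : ℝ) ^ (-((Q : ℝ) * k)) := by
      rw [one_div, inv_pow, ← Real.rpow_natCast, Real.rpow_neg (by norm_num)]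
      push_cast
      rfl
    have h3 : ((2 : ℝ) ^ ((d : ℝ) * p - Q)) ^ k = (2 : ℝ) ^ ((d : ℝ) * p * k + -((Q : ℝ) * k)) := by
      rw [← Real.rpow_natCast, ← Real.rpow_mul (by norm_num)]
      ring_nf
    rw [h1, h2, h3, Real.rpow_add (by norm_num)]
    ring
  simp only [hterm]
  rcases hpQ.lt_or_eq with hlt | heq
  · have hr : (2 : ℝ) ^ ((d : ℝ) * p - Q) < 1 :=
      Real.rpow_lt_one_of_one_lt_of_neg (by norm_num) (by linarith)
    refine Summable.of_nonneg_of_le (fun k => by positivity) (fun k => ?_)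
      (summable_geometric_of_lt_one (by positivity) hr)
    refine mul_le_of_le_one_right (by positivity) ?_
    rw [div_le_one (by positivity)]
    exact Real.one_le_rpow (by linarith [Nat.cast_nonneg (α := ℝ) k]) hp.le
  -- At the critical exponent only the logarithm provides convergence, and p = Q/d > 1.
  · have hp1 : 1 < p := by
      by_contra! hle
      have h1 : (d : ℝ) * p ≤ d := mul_le_of_le_one_right (Nat.cast_nonneg d) hle
      have h2 : (d : ℝ) < Q := by exact_mod_cast hdQ
      linarith
    simp only [heq, sub_self, Real.rpow_zero, one_pow, one_mul]
    have := (summable_nat_add_iff 1).2 (Real.summable_one_div_nat_rpow.2 hp1)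
    simpa using this

theorem lintegral_poleFun_rpow_ne_top {d Q : ℕ} (hdQ : d < Q) {p : ℝ} (hp : 0 < p)
    (hpQ : (d : ℝ) * p ≤ Q) {x₀ : X} {μ : Measure X} {V : ℝ≥0∞} (hV : V ≠ ∞)
    (h : ∀ k : ℕ, μ (Metric.closedBall x₀ ((1 / 2) ^ k)) ≤ (1 / 2) ^ (Q * k) * V) :
    ∫⁻ x, ENNReal.ofReal (poleFun d x₀ x) ^ p ∂μ ≠ ∞ := by
  have h1 : ∫⁻ x, ENNReal.ofReal (poleFun d x₀ x) ^ p ∂μ ≤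
      ∑' k : ℕ, ENNReal.ofReal (poleValue d k ^ p * (1 / 2) ^ (Q * k)) * V := by
    calc _ ≤ ∫⁻ x, ∑' k : ℕ, (Metric.closedBall x₀ ((1 / 2) ^ k)).indicator
            (fun _ => ENNReal.ofReal (poleValue d k) ^ p) x ∂μ :=
          lintegral_mono fun x => poleFun_rpow_le_tsum d hp x₀ x
      _ = ∑' k : ℕ, ∫⁻ x, (Metric.closedBall x₀ ((1 / 2) ^ k)).indicator
            (fun _ => ENNReal.ofReal (poleValue d k) ^ p) x ∂μ :=
          lintegral_tsum fun k =>
            (measurable_const.indicator measurableSet_closedBall).aemeasurable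
      _ ≤ _ := ENNReal.tsum_le_tsum fun k => ?_
    rw [lintegral_indicator_const measurableSet_closedBall,
      ENNReal.ofReal_rpow_of_pos (poleValue_pos d k), ENNReal.ofReal_mul
        (Real.rpow_nonneg (poleValue_pos d k).le p), mul_assoc]
    refine mul_le_mul_right ((h k).trans_eq ?_) _
    rw [ENNReal.ofReal_pow (by norm_num), ENNReal.ofReal_div_of_pos two_pos]
    simp
  refine ne_top_of_le_ne_top ?_ h1
  rw [ENNReal.tsum_mul_right]
  exact ENNReal.mul_ne_top (summable_poleValue_rpow hdQ hp hpQ).tsum_ofReal_ne_top hV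

/-- A system of measures that all give infinite mass to one function of finite energy is
exceptional. -/
theorem pModule_eq_zero {X : Type*} [MeasurableSpace X] {μ : Measure X} {p : ℝ} (hp : 0 < p)
    {E : Set (Measure X)} {f : X → ℝ} (hf : Measurable f) (hf0 : ∀ x, 0 ≤ f x)
    (hfin : ∫⁻ x, ENNReal.ofReal (f x) ^ p ∂μ ≠ ∞)
    (htop : ∀ σ ∈ E, ∫⁻ x, ENNReal.ofReal (f x) ∂σ = ∞) : pModule μ p E = 0 := by
  set I := ∫⁻ x, ENNReal.ofReal (f x) ^ p ∂μ
  -- Infinite integrals survive division by n + 1, while the energy is multiplied by (n + 1)^{-p}.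
  have key : ∀ n : ℕ, pModule μ p E ≤ ENNReal.ofReal (1 / ((n : ℝ) + 1)) ^ p * I := by
    intro n
    have hn : (0 : ℝ) < 1 / ((n : ℝ) + 1) := by positivity
    have hmul : ∀ x, ENNReal.ofReal (1 / ((n : ℝ) + 1) * f x) =
        ENNReal.ofReal (1 / ((n : ℝ) + 1)) * ENNReal.ofReal (f x) := fun x =>
      ENNReal.ofReal_mul hn.le
    have hadm : (fun x => 1 / ((n : ℝ) + 1) * f x) ∈ admissible E := by
      refine ⟨hf.const_mul _, fun x => mul_nonneg hn.le (hf0 x), fun σ hσ => ?_⟩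
      simp only [hmul]
      rw [lintegral_const_mul _ hf.ennreal_ofReal, htop σ hσ,
        ENNReal.mul_top (ENNReal.ofReal_pos.2 hn).ne']
      exact le_top
    refine (iInf₂_le _ hadm).trans_eq ?_
    simp only [hmul, ENNReal.mul_rpow_of_nonneg _ _ hp.le]
    exact lintegral_const_mul _ (hf.ennreal_ofReal.pow_const p)
  have hlim : Tendsto (fun n : ℕ => ENNReal.ofReal (1 / ((n : ℝ) + 1)) ^ p * I) atTop (𝓝 0) := by
    have h1 : Tendsto (fun n : ℕ => ENNReal.ofReal (1 / ((n : ℝ) + 1))) atTop (𝓝 0) := by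
      simpa using ENNReal.tendsto_ofReal tendsto_one_div_add_atTop_nhds_zero_nat
    have h2 := (ENNReal.continuous_rpow_const (y := p)).tendsto 0 |>.comp h1
    rw [ENNReal.zero_rpow_of_pos hp] at h2
    have h3 := ENNReal.Tendsto.mul_const h2 (Or.inr hfin)
    rwa [zero_mul] at h3
  exact le_antisymm (ge_of_tendsto' hlim key) zero_le

end Pole

/-! ### Homogeneous norms, surfaces and the conclusion. -/

namespace CarnotGroup

section HomogeneousMetric

variable {𝔤 G : Type*} [LieRing 𝔤] [LieAlgebra ℝ 𝔤] [FiniteDimensional ℝ 𝔤]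
  [TopologicalSpace 𝔤] [IsTopologicalAddGroup 𝔤] [ContinuousSMul ℝ 𝔤] [T2Space 𝔤]
  [Group G] [TopologicalSpace G] [IsTopologicalGroup G] {C : CarnotGroup 𝔤 G}

theorem IsHomogeneousSubgroup.half_mem_iff {M : Subgroup G} (hM : C.IsHomogeneousSubgroup M)
    (g : G) : C.half g ∈ M ↔ g ∈ M := by
  refine ⟨fun h => ?_, fun h => hM.dilation_mem (1 / 2) (by norm_num) g h⟩
  have h1 := hM.dilation_mem 2 two_pos _ h
  rw [half_apply, C.dilation_dilation] at h1
  norm_num [C.dilation_one] at h1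
  exact h1

namespace HomogeneousNorm

variable (n : HomogeneousNorm C)

theorem dist_def (p q : G) : (letI := n.metricSpace; dist p q) = n.nrm (q⁻¹ * p) := rfl

theorem isIsometricSMul : letI := n.metricSpace; IsIsometricSMul G G := by
  let _ := n.metricSpace
  refine ⟨fun c => Isometry.of_dist_eq fun x y => ?_⟩
  rw [n.dist_def, n.dist_def]
  simp [mul_assoc]

theorem isHalving : letI := n.metricSpace; @IsHalving G _ _ C.half := by
  let _ := n.metricSpace
  intro x y
  rw [n.dist_def, n.dist_def, ← map_inv, ← map_mul, half_apply,
    n.nrm_dilation _ _ (by norm_num)]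
  ring

/-- A small ball lies in the compact image of a Euclidean ball, and dilations carry it onto balls of
arbitrarily large radius. -/
theorem properSpace : letI := n.metricSpace; ProperSpace G := by
  let _ := n.metricSpace
  have hK : IsCompact (C.expEuclidean '' Metric.closedBall 0 1) :=
    (isCompact_closedBall _ _).image C.expEuclidean.continuous
  have h1 : C.expEuclidean 0 = 1 := by
    rw [← C.exp_zero n]
    simp [expEuclidean]
  have hU : C.expEuclidean '' Metric.closedBall 0 1 ∈ 𝓝 (1 : G) := by
    rw [← h1]
    exact C.expEuclidean.isOpenMap.image_mem_nhds (Metric.closedBall_mem_nhds _ one_pos)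
  obtain ⟨c, hc, hcU⟩ := n.exists_lt_mem hU
  have hball : IsCompact (Metric.closedBall (1 : G) (c / 2)) := by
    refine hK.of_isClosed_subset Metric.isClosed_closedBall fun g hg => hcU g ?_
    rw [Metric.mem_closedBall, n.dist_def, inv_one, one_mul] at hg
    linarith
  refine ProperSpace.of_seq_closedBall (x := (1 : G)) (l := atTop)
    (r := fun k : ℕ => 2 ^ k * (c / 2)) ?_ (Eventually.of_forall fun k => ?_)
  · exact (tendsto_pow_atTop_atTop_of_one_lt one_lt_two).atTop_mul_const (by positivity)
  · refine (hball.image (C.continuous_dilation (2 ^ k))).of_isClosed_subset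
      Metric.isClosed_closedBall fun g hg => ⟨C.dilation ((2 ^ k)⁻¹) g, ?_, ?_⟩
    · rw [Metric.mem_closedBall, n.dist_def, inv_one, one_mul] at hg ⊢
      rw [n.nrm_dilation _ _ (by positivity), inv_mul_le_iff₀ (by positivity)]
      exact hg
    · rw [C.dilation_dilation, mul_inv_cancel₀ (by positivity), C.dilation_one]

variable [MeasurableSpace G] [BorelSpace G]

/-- Near each of its points, an intrinsic Lipschitz surface has `𝒮^{d_m}` measure bounded below as
in a `d_m`-dimensional space. -/
theorem exists_le_sphericalMeasure {dt dm : ℕ} (hdm : dm ≠ 0) {S : Set G}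
    (hS : n.IsLipschitzSurface dt dm S) {g₀ : G} (hg₀ : g₀ ∈ S) :
    letI := n.metricSpace
    ∃ κ : ℝ≥0∞, κ ≠ 0 ∧ ∀ k : ℕ, κ * (1 / 2) ^ (dm * k) ≤
      n.sphericalMeasure dm (S ∩ (Metric.closedBall g₀ ((1 / 2) ^ k) \ {g₀})) := by
  let _ := n.metricSpace
  have := n.isIsometricSMul
  have := n.properSpace
  obtain ⟨U, hU, hgU, S', ⟨M, H, hM, hH, hMH, Ω, f, hΩ, ⟨L, hL, hcone⟩, rfl⟩, hSU⟩ := hS.2 g₀ hg₀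
  have hg₀' : g₀ ∈ intrinsicGraph Ω f := (hSU.le ⟨hg₀, hgU⟩).1
  have hnrm : ∀ {K : Subgroup G} (m : K), dist m 1 = n.nrm m := by
    intro K m
    rw [Subtype.dist_eq, n.dist_def, Subgroup.coe_one, inv_one, one_mul]
  obtain ⟨r, hr, hgraph⟩ := hMH.exists_mem_graph_of_cone hM.isHomogeneous.isClosed hH.isClosed
    hΩ hL hg₀' (fun m h hmem hle => by
      have h1 : g₀ * (m * h) ∈ n.cone M H g₀ (1 / L) ∩ intrinsicGraph Ω f :=
        ⟨⟨m, m.2, h, h.2, rfl, by rwa [hnrm, hnrm] at hle⟩, hmem⟩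
      rw [hcone g₀ hg₀'] at h1
      exact h1)
  obtain ⟨ε, hε, hball⟩ := Metric.mem_nhds_iff.1 (hU.mem_nhds hgU)
  -- For a set that is not a closed ball the infimum is over nothing and equals ∞, so the bound
  -- holds for all sets.
  have hw : ∀ s : Set G, Metric.ediam s ^ dm ≤
      ⨅ (x : G) (r : ℝ) (_ : s = Metric.closedBall x r), Metric.ediam s ^ (dm : ℝ) := by
    intro s
    refine le_iInf fun x => le_iInf fun r => le_iInf fun _ => ?_
    rw [ENNReal.rpow_natCast]
  refine hMH.exists_le_mkMetric'_inter n.isHalving hM.isHomogeneous.isClosed hH.isClosed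
    hM.isHomogeneous.half_mem_iff hH.half_mem_iff hdm hM.metricDim_eq hw
    -- This radius keeps the graph points within ε/2 of g₀, hence in U, where the graph and S agree.
    (r := min r (ε / (2 * (1 + L)))) (L := 1 + L) (by positivity) fun m hm1 hmr => ?_
  obtain ⟨g, hgS, hg0, hgm, hgd⟩ := hgraph m hm1 (hmr.trans (min_le_left _ _))
  refine ⟨g, ?_, hg0, hgm, hgd⟩
  refine (hSU.ge ⟨hgS, hball ?_⟩).1
  have h1 : dist m 1 ≤ ε / (2 * (1 + L)) := hmr.trans (min_le_right _ _)
  rw [le_div_iff₀ (by positivity)] at h1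
  rw [Metric.mem_ball]
  linarith

theorem measure_closedBall_dyadic (μ : Measure G) [μ.IsHaarMeasure] (g₀ : G) (k : ℕ) :
    letI := n.metricSpace
    μ (Metric.closedBall g₀ ((1 / 2) ^ k)) =
      (1 / 2) ^ (C.homDim * k) * μ (Metric.closedBall 1 1) := by
  let _ := n.metricSpace
  have := n.isIsometricSMul
  have := n.properSpace
  have h1 := n.isHalving.measure_closedBall_pow μ 1 k
  rw [one_mul, C.mulEquivHaarChar_half (C.exp_zero n)] at h1
  rw [IsHalving.measure_closedBall_center, h1, pow_mul]
  simp [ENNReal.inv_pow]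

theorem pModule_surfaceMeasures_eq_zero (μ : Measure G) [μ.IsHaarMeasure] {dt dm : ℕ}
    (hdm : 1 ≤ dm) (hdmQ : dm + 1 ≤ C.homDim) {p : ℝ} (hp : 0 < p)
    (hpQ : (dm : ℝ) * p ≤ (C.homDim : ℝ)) {Sig : Set (Set G)} {g₀ : G} (hg₀ : ∀ S ∈ Sig, g₀ ∈ S)
    (hSig : ∀ S ∈ Sig, n.IsLipschitzSurface dt dm S) :
    pModule μ p (n.surfaceMeasures dm Sig) = 0 := by
  let _ := n.metricSpace
  have := n.properSpace
  have hdm0 : dm ≠ 0 := by omega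
  refine pModule_eq_zero hp (measurable_poleFun dm g₀) (poleFun_nonneg dm g₀) ?_ ?_
  · exact lintegral_poleFun_rpow_ne_top hdmQ hp hpQ
      (measure_closedBall_lt_top (μ := μ) (x := (1 : G)) (r := 1)).ne
      fun k => (n.measure_closedBall_dyadic μ g₀ k).le
  · rintro _ ⟨S, hS, rfl⟩
    obtain ⟨κ, hκ, h⟩ := n.exists_le_sphericalMeasure hdm0 (hSig S hS) (hg₀ S hS)
    refine lintegral_poleFun_eq_top hdm0 hκ fun k => (h k).trans ?_
    have hset : {y : G | 0 < dist y g₀ ∧ dist y g₀ ≤ (1 / 2) ^ k} =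
        Metric.closedBall g₀ ((1 / 2) ^ k) \ {g₀} := by
      ext y
      simp [dist_pos, and_comm]
    -- Measurability of the punctured ball suffices here; S itself may be any set.
    rw [hset, Measure.restrict_apply
      (measurableSet_closedBall.diff (measurableSet_singleton g₀)), inter_comm]

theorem IsLipschitzGraph.isLipschitzSurface {n : HomogeneousNorm C} {dt dm : ℕ} {S : Set G}
    (hS : n.IsLipschitzGraph dt dm S) (hne : S.Nonempty) : n.IsLipschitzSurface dt dm S :=
  ⟨hne, fun x _ => ⟨univ, isOpen_univ, mem_univ x, S, hS, rfl⟩⟩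

end HomogeneousNorm

end HomogeneousMetric

end CarnotGroup

end

theorem mainTheorem2 {𝔤 G : Type*} [LieRing 𝔤] [LieAlgebra ℝ 𝔤] [FiniteDimensional ℝ 𝔤]
    [TopologicalSpace 𝔤] [IsTopologicalAddGroup 𝔤] [ContinuousSMul ℝ 𝔤] [T2Space 𝔤]
    [Group G] [TopologicalSpace G] [IsTopologicalGroup G] [MeasurableSpace G] [BorelSpace G]
    (C : CarnotGroup 𝔤 G) (n : C.HomogeneousNorm)
    (μ : Measure G) [μ.IsHaarMeasure]
    (dt dm : ℕ) (hdt : 1 ≤ dt) (hdtN : dt + 1 ≤ C.topDim) (hdm : 1 ≤ dm) (hdmQ : dm + 1 ≤ C.homDim)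
    (p : ℝ) (hp : 0 < p) (hpQ : (dm : ℝ) * p ≤ (C.homDim : ℝ))
    (Sig : Set (Set G)) (g₀ : G) (hg₀ : ∀ S ∈ Sig, g₀ ∈ S) :
    ((∀ S ∈ Sig, n.IsLipschitzGraph dt dm S) →
      pModule μ p (n.surfaceMeasures dm Sig) = 0) ∧
    ((∀ S ∈ Sig, n.IsLipschitzSurface dt dm S) →
      pModule μ p (n.surfaceMeasures dm Sig) = 0) := by
  exact ⟨fun h => n.pModule_surfaceMeasures_eq_zero μ hdm hdmQ hp hpQ hg₀ fun S hS =>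
      (h S hS).isLipschitzSurface ⟨g₀, hg₀ S hS⟩,
    fun h => n.pModule_surfaceMeasures_eq_zero μ hdm hdmQ hp hpQ hg₀ h⟩
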